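/- Let $\|A\|=\sup_{\|x\|_2=1}\|Ax\|_2$ denote the operator norm of a real $m\times n$ matrix $A$ from $\ell_2^n$ to $\ell_2^m$, and let $\log$ be the natural logarithm. There are absolute positive constants $C_1$ and $C_2$ such that the following holds. Let $m,n,d$ be integers with $1\le m\le n$ and $1\le d\le n$, and let $\gamma\ge 4$, $\beta\ge 1$ be real numbers. Let $M$ be an $m\times n$ random matrix with entries in $\{0,1\}$ whose rows are independent and each uniformly distributed on the set of all vectors in $\{0,1\}^n$ with exactly $d$ ones, and let $\mathbb{E}M$ be its entrywise expectation. Put $$N=\max\big\{9\min\{d,n-d\},\ 2\gamma\log m\big\}.$$ Then, with probability at least $1-n\,m^{-\gamma}-2n^{-\beta}$, $$\|M-\mathbb{E}M\|\le \frac{2\min\{d,n-d\}}{\sqrt N}+C_1\beta\sqrt N\le C_2\,\beta\,\sqrt{\min\{d,n-d\}+\gamma\log m}$$ (the fraction is read as $0$ if $N=0$, which happens only for $m=1$, $d=n$). In particular, if $m=n$ and $\log n\le d\le n-\log n$, then with probability at least $1-3n^{-1}$, $$\|M-\mathbb{E}M\|=\|M^{T}-\mathbb{E}M^{T}\|\le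 C_2\sqrt d .$$ -/

import Mathlib

open MeasureTheory ProbabilityTheory
open scoped Matrix Matrix.Norms.L2Operator

/-- The set of vectors in `{0, 1}^n` (inside `ℝ^n`) with exactly `d` ones. -/
def zeroOneVectors (n d : ℕ) : Set (Fin n → ℝ) :=
  {v | (∀ j, v j = 0 ∨ v j = 1) ∧ {j | v j = 1}.ncard = d}

/-- `M` is an `m × n` random matrix on `(Ω, P)` whose rows are independent random vectors, each
uniformly distributed on the vectors in `{0, 1}^n` with exactly `d` ones. -/
structure IsRandomCombinatorial {Ω : Type*} [MeasurableSpace Ω] (P : Measure Ω) {m n : ℕ} (d : ℕ)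
    (M : Ω → Matrix (Fin m) (Fin n) ℝ) : Prop where
  measurable_row : ∀ i : Fin m, Measurable (fun ω => M ω i)
  indep_rows : iIndepFun (fun (i : Fin m) (ω : Ω) => M ω i) P
  law_row : ∀ i : Fin m, P.map (fun ω => M ω i) = uniformOn (zeroOneVectors n d)

/-- The entrywise expectation of a random matrix. -/
noncomputable def expectedMatrix {Ω : Type*} [MeasurableSpace Ω] (P : Measure Ω) {m n : ℕ}
    (M : Ω → Matrix (Fin m) (Fin n) ℝ) : Matrix (Fin m) (Fin n) ℝ :=
  Matrix.of fun i j => ∫ ω, M ω i j ∂P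

/-! This is the Kahn–Szemerédi argument, run at the scale `c = √N`. After exchanging zeros and ones
if needed, `d` is the smaller of the two densities. All probability enters through one estimate: by
Maclaurin's inequality, exponential moments of a uniform row are at most those of independent
Poisson entries of mean `d / n` (`average_powersetCard_exp_le`, packaged in `IsPoissonDominated`).
With independent rows this gives the Chernoff bound `IsPoissonDominated.chernoff`.

The norm is tested by bilinear forms on two `1/2`-nets (`l2_opNorm_le_of_net`). For fixed `x`, `y`,
the light couples, `|x i * y j| ≤ c / n`, have bounded exponents at scale `n / c`, so their centered
sum is `O(βc)` except with probability small enough for a union bound over the nets (`prob_net_le`).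

The heavy couples are handled deterministically (`sum_heavy_le`), from row and column sums at most
`c ^ 2` and the discrepancy property. The latter is Chernoff's bound for the edge count between `S`
and `T`, kept for every integer exponent `a`; the best `a` is selected only when two dyadic levels
of `x` and `y` are compared (`dyadic_term_le`). The mean over the heavy couples costs at most `c`.

The three failure events, columns, discrepancy and nets, have probabilities at most `n m^(-γ)`,
`n^(-β)` and `n^(-β)`. This bounds the norm by a multiple of `β√N` alone; the summand `2 min(d, n -
d) / √N` is then added for free. -/

/-! ### Elementary inequalities -/

/-- A geometric sum restricted to the terms below `c` is controlled by its largest term. -/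
theorem sum_pow_ite_le {r : ℝ} (hr0 : 0 < r) (hr1 : r < 1) (K : ℕ) {c : ℝ} (hc : 0 ≤ c) :
    ∑ k ∈ Finset.range K, (if r ^ k ≤ c then r ^ k else 0) ≤ c / (1 - r) := by
  have h1r : 0 < 1 - r := by linarith
  induction K generalizing c with
  | zero => simpa using div_nonneg hc h1r.le
  | succ K ih =>
    by_cases h1 : 1 ≤ c
    · calc ∑ k ∈ Finset.range (K + 1), (if r ^ k ≤ c then r ^ k else 0)
          ≤ ∑ k ∈ Finset.range (K + 1), r ^ k :=
            Finset.sum_le_sum fun k _ => by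
              split_ifs
              · exact le_rfl
              · positivity
        _ ≤ 1 / (1 - r) := by
            rw [le_div_iff₀ h1r, geom_sum_mul_neg]
            have : 0 ≤ r ^ (K + 1) := by positivity
            linarith
        _ ≤ c / (1 - r) := by gcongr
    · rw [Finset.sum_range_succ']
      have h0 : (if r ^ 0 ≤ c then r ^ 0 else 0) = 0 := by simp [h1]
      rw [h0, add_zero]
      -- The leading term 1 exceeds `c`, so the rest is `r` times the same sum with threshold `c /
      -- r`.
      have := ih (c := c / r) (by positivity)
      have h2 : ∀ k, (if r ^ (k + 1) ≤ c then r ^ (k + 1) else 0) =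
          r * (if r ^ k ≤ c / r then r ^ k else 0) := by
        intro k
        have : r ^ (k + 1) ≤ c ↔ r ^ k ≤ c / r := by rw [le_div_iff₀ hr0, ← pow_succ]
        simp only [this]
        split_ifs <;> ring
      simp_rw [h2]
      rw [← Finset.mul_sum]
      calc r * _ ≤ r * (c / r / (1 - r)) := by gcongr
        _ = c / (1 - r) := by field_simp

theorem sum_two_pow_ite_le (K : ℕ) {c : ℝ} (hc : 0 ≤ c) :
    ∑ k ∈ Finset.range K, (if (2 : ℝ) ^ k ≤ c then (2 : ℝ) ^ k else 0) ≤ 2 * c := by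
  induction K with
  | zero => simpa using hc
  | succ K ih =>
    by_cases h : (2 : ℝ) ^ K ≤ c
    · calc ∑ k ∈ Finset.range (K + 1), (if (2 : ℝ) ^ k ≤ c then (2 : ℝ) ^ k else 0)
          ≤ ∑ k ∈ Finset.range (K + 1), (2 : ℝ) ^ k :=
            Finset.sum_le_sum fun k _ => by
              split_ifs
              · exact le_rfl
              · positivity
        _ = 2 * 2 ^ K - 1 := by
            rw [geom_sum_eq (by norm_num)]; ring
        _ ≤ 2 * c := by linarith
    · rw [Finset.sum_range_succ, if_neg h, add_zero]
      exact ih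

/-- Squaring `1 + b/4 ≤ exp (b/4)` reduces this to `(1 - b/4)² ≥ 0`. -/
theorem le_exp_half (b : ℝ) : b ≤ Real.exp (b / 2) := by
  rcases le_or_gt b 0 with hb | hb
  · exact hb.trans (Real.exp_pos _).le
  · have h := Real.add_one_le_exp (b / 4)
    have h2 : Real.exp (b / 2) = Real.exp (b / 4) ^ 2 := by
      rw [← Real.exp_nat_mul]; congr 1; push_cast; ring
    rw [h2]
    nlinarith [sq_nonneg (1 - b / 4)]

/-- If `b ≤ 1 + L` the quotient `(1 + L + b) / (1 + L)` is at most 2; otherwise `exp (-b)` absorbs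
the factor `b` and still leaves `exp (-L/2)`. -/
theorem mul_one_add_log_div_le {b L : ℝ} (hL : 0 ≤ L) :
    Real.exp (-b) * (1 + L + b) / (1 + L) ≤ 2 * Real.exp (-b) + Real.exp (-L / 2) := by
  have hL1 : 0 < 1 + L := by linarith
  have hp := Real.exp_pos (-b)
  have hq := Real.exp_pos (-L / 2)
  rw [div_le_iff₀ hL1]
  rcases le_or_gt b (1 + L) with h | h
  · nlinarith [mul_nonneg hq.le hL1.le, mul_le_mul_of_nonneg_left h hp.le]
  · have h1 : Real.exp (-b) * b ≤ Real.exp (-L / 2) := by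
      calc Real.exp (-b) * b ≤ Real.exp (-b) * Real.exp (b / 2) := by
            gcongr; exact le_exp_half b
        _ = Real.exp (-b / 2) := by rw [← Real.exp_add]; congr 1; ring
        _ ≤ Real.exp (-L / 2) := Real.exp_le_exp.2 (by linarith)
    nlinarith [mul_nonneg hq.le hL, mul_nonneg hp.le hL]


/-- Bounds the entropy term of the discrepancy at levels `u`, `v`. Put `L = log (n v²)`, `b = -log
(t v²)` and `w = log (c v / u)`. Then `log (n / t) = L + b`, and `L` exceeds `log (n u v / c)` by
`w`. Replacing `a` by `1 + L` costs a factor `1 + w`, paid by half of the decay in `q = u / (c v)`;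
the remaining `√q` keeps the sum over `u` geometric. -/
theorem weighted_log_div_le {n c u v t a : ℝ} (hc : 1 ≤ c)
    (hu : 0 < u) (hv : 0 < v) (ht : 0 < t) (htn : t ≤ n)
    (hheavy : c ≤ n * u * v) (huc : u ≤ c * v) (hnv : 1 ≤ n * v ^ 2)
    (ha : 1 + Real.log (n * u * v / c) ≤ a) :
    u * v * (t * (1 + Real.log (n / t)) / a) ≤
      2 * c * (√u / √(c * v)) * (2 * (t * v ^ 2) + v⁻¹ / √n) := by
  have hn0 : 0 < n := ht.trans_le htn
  have hc0 : 0 < c := by linarith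
  have hsn : 0 < √n := Real.sqrt_pos.2 hn0
  have hh1 : 1 ≤ n * u * v / c := by rw [le_div_iff₀ hc0]; linarith
  have hlh : 0 ≤ Real.log (n * u * v / c) := Real.log_nonneg hh1
  have ha0 : 0 < a := by linarith
  obtain ⟨L, hLdef⟩ : ∃ L, L = Real.log (n * v ^ 2) := ⟨_, rfl⟩
  have hL : 0 ≤ L := hLdef ▸ Real.log_nonneg hnv
  obtain ⟨b, hbdef⟩ : ∃ b, b = -Real.log (t * v ^ 2) := ⟨_, rfl⟩
  have hβ : Real.exp (-b) = t * v ^ 2 := by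
    rw [hbdef, neg_neg, Real.exp_log (by positivity)]
  have hLe : Real.exp (-L / 2) = v⁻¹ / √n := by
    have : Real.exp (-L / 2) = (√(n * v ^ 2))⁻¹ := by
      rw [Real.sqrt_eq_rpow, ← Real.rpow_neg (by positivity), Real.rpow_def_of_pos (by positivity)]
      congr 1; rw [← hLdef]; ring
    rw [this, Real.sqrt_mul hn0.le, Real.sqrt_sq hv.le]
    field_simp
  have hlognt : Real.log (n / t) = L + b := by
    rw [hLdef, hbdef, ← sub_eq_add_neg, ← Real.log_div (by positivity) (by positivity)]
    congr 1; field_simp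
  have hLb : 0 ≤ 1 + L + b := by
    have : 0 ≤ Real.log (n / t) := Real.log_nonneg ((one_le_div ht).2 htn)
    linarith
  obtain ⟨w, hwdef⟩ : ∃ w, w = -Real.log (u / (c * v)) := ⟨_, rfl⟩
  have hw : 0 ≤ w := by
    rw [hwdef, neg_nonneg]
    exact Real.log_nonpos (by positivity) ((div_le_one (by positivity)).2 huc)
  have hLw : L = Real.log (n * u * v / c) + w := by
    rw [hLdef, hwdef, ← sub_eq_add_neg, ← Real.log_div (by positivity) (by positivity)]
    congr 1; field_simp
  have hqw : √(u / (c * v)) * (1 + w) ≤ 2 := by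
    have h1 : √(u / (c * v)) = Real.exp (-w / 2) := by
      rw [Real.sqrt_eq_rpow, Real.rpow_def_of_pos (by positivity)]
      congr 1; rw [hwdef]; ring
    have h2 : 1 + w ≤ 2 * Real.exp (w / 2) := by linarith [Real.add_one_le_exp (w / 2)]
    calc √(u / (c * v)) * (1 + w) ≤ Real.exp (-w / 2) * (2 * Real.exp (w / 2)) := by
          rw [h1]; gcongr
      _ = 2 * (Real.exp (-w / 2) * Real.exp (w / 2)) := by ring
      _ = 2 := by rw [← Real.exp_add]; ring_nf; simp
  have hkey := mul_one_add_log_div_le (b := b) hL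
  rw [hβ, hLe] at hkey
  rw [hlognt, ← Real.sqrt_div hu.le]
  obtain ⟨q, hq⟩ : ∃ q, q = u / (c * v) := ⟨_, rfl⟩
  have hq0 : 0 < q := by rw [hq]; positivity
  rw [← hq] at hqw ⊢
  have hfac : q / a ≤ 2 * √q / (1 + L) := by
    rw [div_le_div_iff₀ ha0 (by linarith)]
    have h1 : 1 + L ≤ a * (1 + w) := by
      calc 1 + L = 1 + (Real.log (n * u * v / c) + w) := by rw [hLw]
        _ ≤ (1 + Real.log (n * u * v / c)) * (1 + w) := by nlinarith
        _ ≤ a * (1 + w) := by gcongr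
    calc q * (1 + L) ≤ q * (a * (1 + w)) := by gcongr
      _ = √q * (√q * (1 + w)) * a := by
          nth_rewrite 1 [← Real.mul_self_sqrt hq0.le]; ring
      _ ≤ √q * 2 * a := by gcongr
      _ = 2 * √q * a := by ring
  calc u * v * (t * (1 + (L + b)) / a) = c * (t * v ^ 2 * (1 + L + b)) * (q / a) := by
        rw [hq]; field_simp; ring
    _ ≤ c * (t * v ^ 2 * (1 + L + b)) * (2 * √q / (1 + L)) := by gcongr
    _ = 2 * c * √q * (t * v ^ 2 * (1 + L + b) / (1 + L)) := by ring
    _ ≤ _ := by gcongr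

/-- The contribution of one pair of dyadic levels to the sum over heavy couples. -/
theorem dyadic_term_le {n c B u v s t e : ℝ} (hn : 1 ≤ n) (hc : 1 ≤ c) (hB : 0 ≤ B)
    (hu : 0 < u) (hu1 : u ≤ 1) (hv : 0 < v) (hv1 : v ≤ 1) (hs : 0 ≤ s) (ht : 0 < t)
    (htn : t ≤ n) (hheavy : c ≤ n * u * v) (hrow : e ≤ s * c ^ 2)
    (hdisc : ∀ a : ℕ, 1 ≤ a → (a : ℝ) ≤ n + 2 →
      a * e ≤ c ^ 2 * s * t / n * Real.exp a + B * (t * (1 + Real.log (n / t)))) :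
    u * v * e ≤ s * u * c ^ 2 * (if v ≤ u / c then v else 0) + 8 * c * (s * u ^ 2) * (t * v ^ 2) +
      2 * B * c * ((if √u ≤ √(c * v) then √u else 0) / √(c * v)) *
        (2 * (t * v ^ 2) + (if v⁻¹ ≤ √n then v⁻¹ else 0) / √n) := by
  have hn0 : 0 < n := by linarith
  have hc0 : 0 < c := by linarith
  have hM : 0 ≤ 8 * c * (s * u ^ 2) * (t * v ^ 2) := by positivity
  -- For `v` this small the row sum bound already suffices, with geometric decay in `v`. Otherwise
  -- `u < c v`, as the entropy estimate requires.
  by_cases h : v ≤ u / c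
  · have hT : 0 ≤ 2 * B * c * ((if √u ≤ √(c * v) then √u else 0) / √(c * v)) *
        (2 * (t * v ^ 2) + (if v⁻¹ ≤ √n then v⁻¹ else 0) / √n) := by
      split_ifs <;> positivity
    have : u * v * e ≤ s * u * c ^ 2 * v := by
      calc u * v * e ≤ u * v * (s * c ^ 2) := by gcongr
        _ = _ := by ring
    rw [if_pos h]
    linarith
  rw [if_neg h, mul_zero, zero_add]
  have huc : u ≤ c * v := by
    rw [not_le, div_lt_iff₀ hc0] at h
    linarith
  have hnv : 1 ≤ n * v ^ 2 := by
    have : c ≤ n * (c * v) * v := by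
      calc c ≤ n * u * v := hheavy
        _ ≤ _ := by gcongr
    have h3 : c * 1 ≤ c * (n * v ^ 2) := by
      linarith [this, show n * (c * v) * v = c * (n * v ^ 2) by ring]
    exact le_of_mul_le_mul_left h3 hc0
  have hvn : v⁻¹ ≤ √n := by
    apply Real.le_sqrt_of_sq_le
    rw [inv_pow, inv_le_iff_one_le_mul₀ (by positivity)]
    exact hnv
  rw [if_pos (Real.sqrt_le_sqrt huc), if_pos hvn]
  have hh1 : 1 ≤ n * u * v / c := by rw [le_div_iff₀ hc0]; linarith
  have hh0 : 0 < n * u * v / c := by linarith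
  have hlh : 0 ≤ Real.log (n * u * v / c) := Real.log_nonneg hh1
  -- The exponent balancing the two discrepancy terms: `exp a` is comparable to `n u v / c`, and `a
  -- < log (n u v / c) + 2`, hence the range `a ≤ n + 2`.
  obtain ⟨a, ha⟩ : ∃ a : ℕ, a = ⌈Real.log (n * u * v / c)⌉₊ + 1 := ⟨_, rfl⟩
  have ha1 : 1 + Real.log (n * u * v / c) ≤ a := by
    rw [ha]; push_cast; linarith [Nat.le_ceil (Real.log (n * u * v / c))]
  have ha2 : (a : ℝ) < Real.log (n * u * v / c) + 2 := by
    rw [ha]; push_cast; linarith [Nat.ceil_lt_add_one hlh]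
  have hhn : n * u * v / c ≤ n := by
    rw [div_le_iff₀ hc0]
    calc n * u * v ≤ n * 1 * 1 := by gcongr
      _ ≤ n * c := by nlinarith
  have hd := hdisc a (by omega) (by linarith [Real.log_le_self hh0.le])
  have ha0 : (1 : ℝ) ≤ a := by linarith
  have hea : Real.exp a ≤ 8 * (n * u * v / c) := by
    calc Real.exp a ≤ Real.exp (Real.log (n * u * v / c) + 2) := Real.exp_le_exp.2 ha2.le
      _ = (n * u * v / c) * Real.exp 1 ^ 2 := by
        rw [Real.exp_add, Real.exp_log hh0, ← Real.exp_nat_mul]; norm_num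
      _ ≤ (n * u * v / c) * 2.8 ^ 2 := by
        gcongr; linarith [Real.exp_one_lt_d9]
      _ ≤ 8 * (n * u * v / c) := by nlinarith
  have h1 : e ≤ c ^ 2 * s * t / n * (8 * (n * u * v / c)) +
      B * (t * (1 + Real.log (n / t)) / a) := by
    have : e ≤ (c ^ 2 * s * t / n * Real.exp a + B * (t * (1 + Real.log (n / t)))) / a := by
      rw [le_div_iff₀ (by linarith)]; linarith
    rw [add_div, mul_div_assoc B] at this
    refine this.trans (add_le_add_left ?_ _)
    calc c ^ 2 * s * t / n * Real.exp a / a ≤ c ^ 2 * s * t / n * Real.exp a :=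
          div_le_self (by positivity) ha0
      _ ≤ _ := by gcongr
  have h2 : u * v * (c ^ 2 * s * t / n * (8 * (n * u * v / c))) =
      8 * c * (s * u ^ 2) * (t * v ^ 2) := by
    field_simp
  have h3 := mul_le_mul_of_nonneg_left
    (weighted_log_div_le hc hu hv ht htn hheavy huc hnv ha1) hB
  have h4 := mul_le_mul_of_nonneg_left h1 (mul_pos hu hv).le
  rw [mul_add, h2] at h4
  linarith

/-- The sum over all pairs of dyadic levels containing a heavy couple. -/
theorem sum_dyadic_le {n c B : ℝ} (hn : 1 ≤ n) (hc : 1 ≤ c) (hB : 0 ≤ B) (K : ℕ) (s t : ℕ → ℝ)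
    (e : ℕ → ℕ → ℝ) (F : Finset (ℕ × ℕ)) (hF : F ⊆ Finset.range K ×ˢ Finset.range K)
    (hs : ∀ k, 0 ≤ s k) (ht : ∀ l, 0 ≤ t l) (htn : ∀ l, t l ≤ n)
    (hS : ∑ k ∈ Finset.range K, s k * ((1 / 2 : ℝ) ^ k) ^ 2 ≤ 4)
    (hT : ∑ l ∈ Finset.range K, t l * ((1 / 2 : ℝ) ^ l) ^ 2 ≤ 4)
    (h : ∀ p ∈ F, 0 < t p.2 ∧ c ≤ n * (1 / 2) ^ p.1 * (1 / 2) ^ p.2 ∧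
      e p.1 p.2 ≤ s p.1 * c ^ 2 ∧ ∀ a : ℕ, 1 ≤ a → (a : ℝ) ≤ n + 2 →
        a * e p.1 p.2 ≤ c ^ 2 * s p.1 * t p.2 / n * Real.exp a +
          B * (t p.2 * (1 + Real.log (n / t p.2)))) :
    ∑ p ∈ F, (1 / 2 : ℝ) ^ p.1 * (1 / 2) ^ p.2 * e p.1 p.2 ≤ (136 + 80 * B) * c := by
  have hn0 : 0 < n := by linarith
  have hc0 : 0 < c := by linarith
  have hsn : 0 < √n := Real.sqrt_pos.2 hn0
  have hpow : ∀ k : ℕ, (0 : ℝ) < (1 / 2) ^ k := fun k => by positivity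
  have hpow1 : ∀ k : ℕ, (1 / 2 : ℝ) ^ k ≤ 1 := fun k => pow_le_one₀ (by norm_num) (by norm_num)
  let G1 : ℕ → ℕ → ℝ := fun k l => s k * (1 / 2) ^ k * c ^ 2 *
    (if (1 / 2 : ℝ) ^ l ≤ (1 / 2) ^ k / c then (1 / 2) ^ l else 0)
  let G2 : ℕ → ℕ → ℝ := fun k l => 8 * c * (s k * ((1 / 2) ^ k) ^ 2) * (t l * ((1 / 2) ^ l) ^ 2)
  let G3 : ℕ → ℕ → ℝ := fun k l => 2 * B * c *
    ((if √((1 / 2) ^ k) ≤ √(c * (1 / 2) ^ l) then √((1 / 2) ^ k) else 0) / √(c * (1 / 2) ^ l)) *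
        (2 * (t l * ((1 / 2) ^ l) ^ 2) +
          (if ((1 / 2 : ℝ) ^ l)⁻¹ ≤ √n then ((1 / 2) ^ l)⁻¹ else 0) / √n)
  have hG1 : ∀ k l, 0 ≤ G1 k l := fun k l => by
    have := hs k
    simp only [G1]; split_ifs <;> positivity
  have hG2 : ∀ k l, 0 ≤ G2 k l := fun k l => by
    have := hs k
    have := ht l
    simp only [G2]; positivity
  have hG3 : ∀ k l, 0 ≤ G3 k l := fun k l => by
    have := ht l
    simp only [G3]; split_ifs <;> positivity
  have hsum : ∑ p ∈ F, (1 / 2 : ℝ) ^ p.1 * (1 / 2) ^ p.2 * e p.1 p.2 ≤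
      ∑ k ∈ Finset.range K, ∑ l ∈ Finset.range K, (G1 k l + G2 k l + G3 k l) := by
    rw [← Finset.sum_product']
    refine (Finset.sum_le_sum (g := fun p => G1 p.1 p.2 + G2 p.1 p.2 + G3 p.1 p.2) ?_).trans
      (Finset.sum_le_sum_of_subset_of_nonneg hF ?_)
    · intro p hp
      obtain ⟨h1, h2, h3, h4⟩ := h p hp
      exact dyadic_term_le hn hc hB (hpow _) (hpow1 _) (hpow _) (hpow1 _) (hs _) h1 (htn _) h2 h3 h4
    · intro p _ _
      linarith [hG1 p.1 p.2, hG2 p.1 p.2, hG3 p.1 p.2]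
  -- The geometric sum over `l` gives `2c` times the mass at level `k`, and these masses total at
  -- most 4.
  have b1 : ∑ k ∈ Finset.range K, ∑ l ∈ Finset.range K, G1 k l ≤ 8 * c := by
    calc ∑ k ∈ Finset.range K, ∑ l ∈ Finset.range K, G1 k l
        ≤ ∑ k ∈ Finset.range K, 2 * c * (s k * ((1 / 2) ^ k) ^ 2) := by
          refine Finset.sum_le_sum fun k _ => ?_
          simp only [G1]
          rw [← Finset.mul_sum]
          have := sum_pow_ite_le (r := 1 / 2) (by norm_num) (by norm_num) K
            (c := (1 / 2) ^ k / c) (by positivity)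
          have hk := hs k
          calc _ ≤ s k * (1 / 2) ^ k * c ^ 2 * ((1 / 2) ^ k / c / (1 - 1 / 2)) := by gcongr
            _ = _ := by field_simp; norm_num
      _ ≤ 2 * c * 4 := by rw [← Finset.mul_sum]; gcongr
      _ = 8 * c := by ring
  have b2 : ∑ k ∈ Finset.range K, ∑ l ∈ Finset.range K, G2 k l ≤ 128 * c := by
    simp only [G2]
    simp_rw [← Finset.mul_sum]
    rw [← Finset.sum_mul, ← Finset.mul_sum]
    have : 0 ≤ ∑ l ∈ Finset.range K, t l * ((1 / 2 : ℝ) ^ l) ^ 2 :=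
      Finset.sum_nonneg fun l _ => mul_nonneg (ht l) (by positivity)
    calc _ ≤ 8 * c * 4 * 4 := by gcongr
      _ = 128 * c := by ring
  -- Summing over `k` first, ratio `√(1/2) ≤ 3/4` gives the factor 4; the sum over `l` then gives `2
  -- * 4 + 2`.
  have b3 : ∑ k ∈ Finset.range K, ∑ l ∈ Finset.range K, G3 k l ≤ 80 * B * c := by
    rw [Finset.sum_comm]
    calc ∑ l ∈ Finset.range K, ∑ k ∈ Finset.range K, G3 k l
        ≤ ∑ l ∈ Finset.range K, 2 * B * c * 4 * (2 * (t l * ((1 / 2) ^ l) ^ 2) +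
          (if (2 : ℝ) ^ l ≤ √n then 2 ^ l else 0) / √n) := by
          refine Finset.sum_le_sum fun l _ => ?_
          simp only [G3]
          have hl : ((1 / 2 : ℝ) ^ l)⁻¹ = 2 ^ l := by simp
          rw [hl, ← Finset.sum_mul, ← Finset.mul_sum, ← Finset.sum_div]
          have h0 : 0 ≤ 2 * (t l * ((1 / 2) ^ l) ^ 2) +
            (if (2 : ℝ) ^ l ≤ √n then 2 ^ l else 0) / √n := by
            have := ht l
            split_ifs <;> positivity
          have hk : ∀ k : ℕ, √((1 / 2 : ℝ) ^ k) = √(1 / 2) ^ k := fun k => by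
            rw [Real.sqrt_eq_iff_mul_self_eq (by positivity) (by positivity), ← mul_pow,
              Real.mul_self_sqrt (by norm_num)]
          simp_rw [hk]
          have hr : √(1 / 2 : ℝ) ≤ 3 / 4 := by
            rw [Real.sqrt_le_left (by norm_num)]; norm_num
          have hx : 0 < √(c * (1 / 2) ^ l) := Real.sqrt_pos.2 (by positivity)
          have := sum_pow_ite_le (r := √(1 / 2)) (by positivity) (by linarith) K
            (c := √(c * (1 / 2) ^ l)) (by positivity)
          gcongr
          rw [div_le_iff₀ hx]
          refine this.trans ?_
          rw [div_le_iff₀ (by linarith)]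
          nlinarith
      _ ≤ 2 * B * c * 4 * (2 * 4 + 2) := by
          rw [← Finset.mul_sum, Finset.sum_add_distrib, ← Finset.mul_sum, ← Finset.sum_div]
          gcongr
          rw [div_le_iff₀ hsn]
          exact sum_two_pow_ite_le K hsn.le
      _ = 80 * B * c := by ring
  simp_rw [Finset.sum_add_distrib] at hsum
  linarith

/-! ### Dyadic levels and the sum over heavy couples -/

/-- The function `t log (e n / t)`, the entropy of the subsets of cardinality `t` of a set of
cardinality `n`. -/
noncomputable def subsetEntropy (n t : ℝ) : ℝ := t * (1 + Real.log (n / t))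

/-- The discrepancy property of a nonnegative array. -/
def HasDiscrepancy {ι κ : Type*} (A : ι → κ → ℝ) (n c B : ℝ) : Prop :=
  ∀ (S : Finset ι) (T : Finset κ), S.Nonempty → T.Nonempty → ∀ a : ℕ, 1 ≤ a → (a : ℝ) ≤ n + 2 →
    a * ∑ i ∈ S, ∑ j ∈ T, A i j ≤ c ^ 2 * S.card * T.card / n * Real.exp a +
      B * subsetEntropy n (max S.card T.card : ℕ)

theorem HasDiscrepancy.swap {ι κ : Type*} {A : ι → κ → ℝ} {n c B : ℝ}
    (h : HasDiscrepancy A n c B) : HasDiscrepancy (fun j i => A i j) n c B := by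
  intro S T hS hT a ha han
  have := h T S hT hS a ha han
  rw [Finset.sum_comm, max_comm]
  convert this using 3
  ring

theorem exists_dyadic_level {ι : Type*} [Fintype ι] (x : ι → ℝ) (hx : ∑ i, x i ^ 2 ≤ 1) :
    ∃ f : ι → ℕ, ∀ i, x i ≠ 0 → (1 / 2 : ℝ) ^ (f i + 1) < |x i| ∧ |x i| ≤ (1 / 2) ^ (f i) := by
  have : ∀ i, ∃ k : ℕ, x i ≠ 0 → (1 / 2 : ℝ) ^ (k + 1) < |x i| ∧ |x i| ≤ (1 / 2) ^ k := by
    intro i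
    by_cases h : x i = 0
    · exact ⟨0, fun h' => absurd h h'⟩
    · have h1 : |x i| ≤ 1 := by
        rw [← sq_le_one_iff_abs_le_one]
        exact (Finset.single_le_sum (f := fun i => x i ^ 2) (fun i _ => sq_nonneg _)
          (Finset.mem_univ i)).trans hx
      obtain ⟨k, hk⟩ := exists_nat_pow_near_of_lt_one (abs_pos.2 h) h1
        (by norm_num : (0 : ℝ) < 1 / 2) (by norm_num)
      exact ⟨k, fun _ => hk⟩
  choose f hf using this
  exact ⟨f, hf⟩

/-- On level `k`, `|x i|` is within a factor 2 of `(1/2)^k`, so rounding up costs a factor 4 in the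
squared norm. -/
theorem sum_card_level_le {ι : Type*} [Fintype ι] (x : ι → ℝ) (hx : ∑ i, x i ^ 2 ≤ 1)
    (f : ι → ℕ) (hf : ∀ i, x i ≠ 0 → (1 / 2 : ℝ) ^ (f i + 1) < |x i|) (K : ℕ) :
    ∑ k ∈ Finset.range K,
      ((Finset.univ.filter fun i => x i ≠ 0 ∧ f i = k).card : ℝ) * ((1 / 2 : ℝ) ^ k) ^ 2 ≤ 4 := by
  classical
  calc ∑ k ∈ Finset.range K,
      ((Finset.univ.filter fun i => x i ≠ 0 ∧ f i = k).card : ℝ) * ((1 / 2 : ℝ) ^ k) ^ 2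
      ≤ ∑ k ∈ Finset.range K, ∑ i, if f i = k then 4 * x i ^ 2 else 0 := by
        refine Finset.sum_le_sum fun k _ => ?_
        rw [← nsmul_eq_mul, ← Finset.sum_const, Finset.sum_filter]
        refine Finset.sum_le_sum fun i _ => ?_
        by_cases h : x i = 0
        · simp [h]
        · by_cases hk : f i = k
          · have h1 := hf i h
            rw [hk, pow_succ] at h1
            have h0 : (0 : ℝ) < (1 / 2) ^ k := by positivity
            simp only [h, hk, ne_eq, not_false_eq_true, and_self, if_true]
            rw [← sq_abs (x i)]
            nlinarith
          · simp [hk]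
    _ = ∑ i, ∑ k ∈ Finset.range K, if f i = k then 4 * x i ^ 2 else 0 := Finset.sum_comm
    _ ≤ ∑ i, 4 * x i ^ 2 := by
        refine Finset.sum_le_sum fun i _ => ?_
        rw [Finset.sum_ite_eq]
        split_ifs
        · exact le_rfl
        · positivity
    _ ≤ 4 := by rw [← Finset.mul_sum]; linarith

theorem sum_dyadic_level_le {ι κ : Type*} [Fintype ι] [Fintype κ] {A : ι → κ → ℝ} {n c B : ℝ}
    (hA : ∀ i j, 0 ≤ A i j) (hn : 1 ≤ n) (hc : 1 ≤ c) (hB : 0 ≤ B)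
    (hκ : (Fintype.card κ : ℝ) ≤ n) (hrow : ∀ i, ∑ j, A i j ≤ c ^ 2)
    (hdisc : HasDiscrepancy A n c B) {S : ℕ → Finset ι} {T : ℕ → Finset κ} {K : ℕ}
    (hS : ∑ k ∈ Finset.range K, ((S k).card : ℝ) * ((1 / 2 : ℝ) ^ k) ^ 2 ≤ 4)
    (hT : ∑ l ∈ Finset.range K, ((T l).card : ℝ) * ((1 / 2 : ℝ) ^ l) ^ 2 ≤ 4)
    (F : Finset (ℕ × ℕ)) (hF : F ⊆ Finset.range K ×ˢ Finset.range K)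
    (h : ∀ p ∈ F, (S p.1).Nonempty ∧ (T p.2).Nonempty ∧ (S p.1).card ≤ (T p.2).card ∧
      c ≤ n * (1 / 2) ^ p.1 * (1 / 2) ^ p.2) :
    ∑ p ∈ F, (1 / 2 : ℝ) ^ p.1 * (1 / 2) ^ p.2 * ∑ i ∈ S p.1, ∑ j ∈ T p.2, A i j ≤
      (136 + 80 * B) * c := by
  refine sum_dyadic_le hn hc hB K (fun k => (S k).card) (fun l => (T l).card)
    (fun k l => ∑ i ∈ S k, ∑ j ∈ T l, A i j) F hF (fun _ => by positivity) (fun _ => by positivity)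
    (fun l => le_trans (by exact_mod_cast Finset.card_le_univ _) hκ) hS hT ?_
  intro p hp
  obtain ⟨h1, h2, h3, h4⟩ := h p hp
  refine ⟨by exact_mod_cast h2.card_pos, h4, ?_, ?_⟩
  · calc ∑ i ∈ S p.1, ∑ j ∈ T p.2, A i j ≤ ∑ i ∈ S p.1, c ^ 2 :=
          Finset.sum_le_sum fun i _ => (Finset.sum_le_sum_of_subset_of_nonneg
            (Finset.subset_univ _) fun j _ _ => hA i j).trans (hrow i)
      _ = _ := by rw [Finset.sum_const, nsmul_eq_mul]
  · intro a ha han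
    have := hdisc _ _ h1 h2 a ha han
    rwa [max_eq_right h3] at this

/-- **Heavy couples.** A nonnegative array with bounded row and column sums and the discrepancy
property has a small bilinear sum over the heavy couples. -/
theorem sum_heavy_le {ι κ : Type*} [Fintype ι] [Fintype κ] {A : ι → κ → ℝ} {n c B : ℝ}
    (hA : ∀ i j, 0 ≤ A i j) (hn : 1 ≤ n) (hc : 1 ≤ c) (hB : 0 ≤ B)
    (hι : (Fintype.card ι : ℝ) ≤ n) (hκ : (Fintype.card κ : ℝ) ≤ n)
    (hrow : ∀ i, ∑ j, A i j ≤ c ^ 2) (hcol : ∀ j, ∑ i, A i j ≤ c ^ 2)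
    (hdisc : HasDiscrepancy A n c B) {x : ι → ℝ} {y : κ → ℝ} (hx : ∑ i, x i ^ 2 ≤ 1)
    (hy : ∑ j, y j ^ 2 ≤ 1) :
    ∑ i, ∑ j, (if c / n < |x i * y j| then |x i * y j| * A i j else 0) ≤
      2 * ((136 + 80 * B) * c) := by
  classical
  have hn0 : 0 < n := by linarith
  obtain ⟨f, hf⟩ := exists_dyadic_level x hx
  obtain ⟨g, hg⟩ := exists_dyadic_level y hy
  set K := max (Finset.univ.sup f) (Finset.univ.sup g) + 1 with hK
  have hfK : ∀ i, f i < K := fun i =>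
    Nat.lt_succ_of_le ((Finset.le_sup (Finset.mem_univ i)).trans (le_max_left _ _))
  have hgK : ∀ j, g j < K := fun j =>
    Nat.lt_succ_of_le ((Finset.le_sup (Finset.mem_univ j)).trans (le_max_right _ _))
  set S : ℕ → Finset ι := fun k => Finset.univ.filter fun i => x i ≠ 0 ∧ f i = k with hSdef
  set T : ℕ → Finset κ := fun k => Finset.univ.filter fun j => y j ≠ 0 ∧ g j = k with hTdef
  have hS := sum_card_level_le x hx f (fun i hi => (hf i hi).1) K
  have hT := sum_card_level_le y hy g (fun i hi => (hg i hi).1) K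
  set F := (Finset.range K ×ˢ Finset.range K).filter fun p => (S p.1).Nonempty ∧ (T p.2).Nonempty ∧
    c ≤ n * (1 / 2) ^ p.1 * (1 / 2) ^ p.2 with hFdef
  set w : ℕ × ℕ → ℝ := fun p =>
    (1 / 2 : ℝ) ^ p.1 * (1 / 2) ^ p.2 * ∑ i ∈ S p.1, ∑ j ∈ T p.2, A i j with hw
  have hF1 : ∑ p ∈ F.filter (fun p => (S p.1).card ≤ (T p.2).card), w p ≤ (136 + 80 * B) * c := by
    refine sum_dyadic_level_le hA hn hc hB hκ hrow hdisc hS hT _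
      ((Finset.filter_subset _ _).trans (Finset.filter_subset _ _)) ?_
    intro p hp
    simp only [hFdef, Finset.mem_filter] at hp
    exact ⟨hp.1.2.1, hp.1.2.2.1, hp.2, hp.1.2.2.2⟩
  have hF2 : ∑ p ∈ F.filter (fun p => ¬ (S p.1).card ≤ (T p.2).card), w p ≤
      (136 + 80 * B) * c := by
    -- When the row set is the larger one, rows and columns exchange roles in the transposed array;
    -- here the column sums are needed.
    have := sum_dyadic_level_le (A := fun j i => A i j) (fun j i => hA i j) hn hc hB hι hcol
      hdisc.swap hT hS
      ((F.filter (fun p => ¬ (S p.1).card ≤ (T p.2).card)).map (Equiv.prodComm ℕ ℕ).toEmbedding)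
      (by
        intro p hp
        simp only [hFdef, Finset.mem_map_equiv, Finset.mem_filter, Finset.mem_product] at hp ⊢
        exact ⟨hp.1.1.2, hp.1.1.1⟩)
      (by
        intro p hp
        simp only [hFdef, Finset.mem_map_equiv, Finset.mem_filter] at hp
        obtain ⟨⟨_, h1, h2, h3⟩, h4⟩ := hp
        refine ⟨h2, h1, (not_le.1 h4).le, h3.trans_eq ?_⟩
        simp only [Equiv.prodComm_symm, Equiv.prodComm_apply, Prod.fst_swap, Prod.snd_swap]
        ring)
    rw [Finset.sum_map] at this
    refine (Finset.sum_congr rfl fun p _ => ?_).trans_le this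
    change (1 / 2 : ℝ) ^ p.1 * (1 / 2) ^ p.2 * ∑ i ∈ S p.1, ∑ j ∈ T p.2, A i j =
      (1 / 2 : ℝ) ^ p.2 * (1 / 2) ^ p.1 * ∑ j ∈ T p.2, ∑ i ∈ S p.1, A i j
    rw [Finset.sum_comm]
    ring
  have hF12 : ∑ p ∈ F, w p ≤ 2 * ((136 + 80 * B) * c) := by
    rw [← Finset.sum_filter_add_sum_filter_not F (fun p => (S p.1).card ≤ (T p.2).card)]
    linarith
  refine le_trans ?_ hF12
  set H := (Finset.univ : Finset (ι × κ)).filter fun q => c / n < |x q.1 * y q.2| with hH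
  have hne : ∀ q ∈ H, x q.1 ≠ 0 ∧ y q.2 ≠ 0 := by
    intro q hq
    have h1 : c / n < |x q.1 * y q.2| := (Finset.mem_filter.1 hq).2
    have h2 : 0 < |x q.1 * y q.2| := lt_of_le_of_lt (by positivity) h1
    exact mul_ne_zero_iff.1 (abs_pos.1 h2)
  have hub : ∀ q ∈ H, |x q.1 * y q.2| ≤ (1 / 2) ^ f q.1 * (1 / 2) ^ g q.2 := by
    intro q hq
    rw [abs_mul]
    gcongr
    · exact (hf _ (hne q hq).1).2
    · exact (hg _ (hne q hq).2).2
  have hmaps : ∀ q ∈ H, (f q.1, g q.2) ∈ F := by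
    intro q hq
    simp only [hFdef, Finset.mem_filter, Finset.mem_product, Finset.mem_range]
    refine ⟨⟨hfK _, hgK _⟩, ⟨q.1, ?_⟩, ⟨q.2, ?_⟩, ?_⟩
    · simp [hSdef, (hne q hq).1]
    · simp [hTdef, (hne q hq).2]
    · have h1 : c / n < |x q.1 * y q.2| := (Finset.mem_filter.1 hq).2
      have := h1.le.trans (hub q hq)
      rw [div_le_iff₀ hn0] at this
      linarith
  calc ∑ i, ∑ j, (if c / n < |x i * y j| then |x i * y j| * A i j else 0)
      = ∑ q ∈ H, |x q.1 * y q.2| * A q.1 q.2 := by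
        rw [hH, Finset.sum_filter, Fintype.sum_prod_type]
    _ ≤ ∑ q ∈ H, (1 / 2) ^ f q.1 * (1 / 2) ^ g q.2 * A q.1 q.2 :=
        Finset.sum_le_sum fun q hq => mul_le_mul_of_nonneg_right (hub q hq) (hA _ _)
    _ = ∑ p ∈ F, ∑ q ∈ H with (f q.1, g q.2) = p, (1 / 2) ^ f q.1 * (1 / 2) ^ g q.2 * A q.1 q.2 :=
        (Finset.sum_fiberwise_of_maps_to hmaps _).symm
    _ ≤ ∑ p ∈ F, w p := by
        refine Finset.sum_le_sum fun p _ => ?_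
        rw [hw]
        simp only
        rw [← Finset.sum_product', Finset.mul_sum]
        calc ∑ q ∈ H with (f q.1, g q.2) = p, (1 / 2 : ℝ) ^ f q.1 * (1 / 2) ^ g q.2 * A q.1 q.2
            = ∑ q ∈ H with (f q.1, g q.2) = p, (1 / 2) ^ p.1 * (1 / 2) ^ p.2 * A q.1 q.2 := by
              refine Finset.sum_congr rfl fun q hq => ?_
              rw [← (Finset.mem_filter.1 hq).2]
          _ ≤ _ := by
              refine Finset.sum_le_sum_of_subset_of_nonneg ?_ ?_
              · intro q hq
                obtain ⟨hq1, hq2⟩ := Finset.mem_filter.1 hq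
                simp [hSdef, hTdef, ← hq2, hne q hq1]
              · intro q _ _
                have := hA q.1 q.2
                positivity

/-! ### Nets and the operator norm -/

/-- A maximal 1-separated subset of the ball of radius 2, scaled by 1/2: maximality gives the net
property, and a volume bound gives the cardinality. -/
theorem exists_half_net (n : ℕ) : ∃ s : Finset (EuclideanSpace ℝ (Fin n)), s.card ≤ 5 ^ n ∧
    (∀ z ∈ s, ‖z‖ ≤ 1) ∧ ∀ x : EuclideanSpace ℝ (Fin n), ‖x‖ ≤ 1 → ∃ z ∈ s, ‖x - z‖ ≤ 1 / 2 := by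
  classical
  let Sep : Finset (EuclideanSpace ℝ (Fin n)) → Prop := fun s =>
    (∀ c ∈ s, ‖c‖ ≤ 2) ∧ ∀ c ∈ s, ∀ d ∈ s, c ≠ d → 1 ≤ ‖c - d‖
  have hcard : ∀ s, Sep s → s.card ≤ 5 ^ n := fun s hs => by
    simpa using Besicovitch.card_le_of_separated s hs.1 hs.2
  have hne : {k | ∃ s, Sep s ∧ s.card = k}.Nonempty := ⟨0, ∅, by simp [Sep], rfl⟩
  have hbdd : BddAbove {k | ∃ s, Sep s ∧ s.card = k} :=
    ⟨5 ^ n, by rintro k ⟨s, hs, rfl⟩; exact hcard s hs⟩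
  obtain ⟨s, hs, hsmax⟩ := Nat.sSup_mem hne hbdd
  refine ⟨s.image fun c => (1 / 2 : ℝ) • c, Finset.card_image_le.trans (hcard s hs), ?_, ?_⟩
  · intro z hz
    obtain ⟨c, hc, rfl⟩ := Finset.mem_image.1 hz
    rw [norm_smul]
    have := hs.1 c hc
    norm_num
    linarith
  · intro x hx
    suffices h : ∃ c ∈ s, ‖(2 : ℝ) • x - c‖ ≤ 1 by
      obtain ⟨c, hc, h⟩ := h
      refine ⟨_, Finset.mem_image_of_mem _ hc, ?_⟩
      have : x - (1 / 2 : ℝ) • c = (1 / 2 : ℝ) • ((2 : ℝ) • x - c) := by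
        rw [smul_sub, smul_smul]; norm_num
      rw [this, norm_smul]
      norm_num
      linarith
    by_contra! h
    have hx2 : (2 : ℝ) • x ∉ s := fun hmem => by
      have := h _ hmem
      rw [sub_self, norm_zero] at this
      linarith
    have hS : Sep (insert ((2 : ℝ) • x) s) := by
      refine ⟨?_, ?_⟩
      · intro c hc
        rcases Finset.mem_insert.1 hc with rfl | hc
        · rw [norm_smul]; norm_num; linarith
        · exact hs.1 c hc
      · intro c hc d hd hcd
        rcases Finset.mem_insert.1 hc with rfl | hc <;> rcases Finset.mem_insert.1 hd with rfl | hd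
        · exact absurd rfl hcd
        · exact (h d hd).le
        · rw [norm_sub_rev]; exact (h c hc).le
        · exact hs.2 c hc d hd hcd
    have := le_csSup hbdd ⟨_, hS, rfl⟩
    rw [Finset.card_insert_of_notMem hx2, hsmax] at this
    omega

theorem norm_le_of_inner_net_le {E : Type*} [NormedAddCommGroup E] [InnerProductSpace ℝ E]
    {s : Finset E} (hs : ∀ x : E, ‖x‖ ≤ 1 → ∃ z ∈ s, ‖x - z‖ ≤ 1 / 2) {z : E} {t : ℝ} (ht : 0 ≤ t)
    (h : ∀ x ∈ s, inner ℝ x z ≤ t) : ‖z‖ ≤ 2 * t := by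
  rcases eq_or_ne z 0 with rfl | hz
  · simpa using ht
  have hz0 : 0 < ‖z‖ := norm_pos_iff.2 hz
  obtain ⟨x, hx, hxz⟩ := hs (‖z‖⁻¹ • z) (by rw [norm_smul, norm_inv, norm_norm]; field_simp; rfl)
  have h1 : inner ℝ (‖z‖⁻¹ • z) z = ‖z‖ := by
    rw [real_inner_smul_left, real_inner_self_eq_norm_sq]; field_simp
  have h2 : inner ℝ (‖z‖⁻¹ • z) z = inner ℝ x z + inner ℝ (‖z‖⁻¹ • z - x) z := by
    rw [inner_sub_left]; ring
  have h3 := real_inner_le_norm (‖z‖⁻¹ • z - x) z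
  have h4 : ‖‖z‖⁻¹ • z - x‖ * ‖z‖ ≤ 1 / 2 * ‖z‖ := by gcongr
  linarith [h x hx]

/-- The operator norm of a matrix is controlled by its bilinear form on two nets. -/
theorem l2_opNorm_le_of_net {m n : ℕ} {s : Finset (EuclideanSpace ℝ (Fin m))}
    {r : Finset (EuclideanSpace ℝ (Fin n))}
    (hs : ∀ x : EuclideanSpace ℝ (Fin m), ‖x‖ ≤ 1 → ∃ z ∈ s, ‖x - z‖ ≤ 1 / 2)
    (hr : ∀ x : EuclideanSpace ℝ (Fin n), ‖x‖ ≤ 1 → ∃ z ∈ r, ‖x - z‖ ≤ 1 / 2)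
    (A : Matrix (Fin m) (Fin n) ℝ) {t : ℝ} (ht : 0 ≤ t)
    (h : ∀ x ∈ s, ∀ y ∈ r, ∑ i, ∑ j, x i * y j * A i j ≤ t) : ‖A‖ ≤ 4 * t := by
  rw [Matrix.l2_opNorm_def]
  set T : EuclideanSpace ℝ (Fin n) →L[ℝ] EuclideanSpace ℝ (Fin m) :=
    (Matrix.toEuclideanLin (𝕜 := ℝ) (m := Fin m) (n := Fin n)).trans
      LinearMap.toContinuousLinearMap A with hT
  have hin : ∀ x y, inner ℝ x (T y) = ∑ i, ∑ j, x i * y j * A i j := by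
    intro x y
    have : ∀ i, (T y) i = ∑ j, A i j * y j := fun i => by
      simp [hT, Matrix.toLpLin_apply, Matrix.mulVec, dotProduct]
    simp only [PiLp.inner_apply, this, RCLike.inner_apply, conj_trivial, Finset.sum_mul]
    exact Finset.sum_congr rfl fun i _ => Finset.sum_congr rfl fun j _ => by ring
  have hy : ∀ y ∈ r, ‖T y‖ ≤ 2 * t := fun y hy =>
    norm_le_of_inner_net_le hs ht fun x hx => (hin x y).trans_le (h x hx y hy)
  -- The error of the second net is absorbed into the left side; each net costs a factor 2.
  have : ‖T‖ ≤ 2 * t + ‖T‖ / 2 := by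
    refine T.opNorm_le_of_unit_norm (by positivity) fun y hy1 => ?_
    obtain ⟨z, hz, hyz⟩ := hr y hy1.le
    calc ‖T y‖ = ‖T z + T (y - z)‖ := by rw [map_sub, add_sub_cancel]
      _ ≤ ‖T z‖ + ‖T (y - z)‖ := norm_add_le _ _
      _ ≤ 2 * t + ‖T‖ * (1 / 2) := by
          gcongr
          · exact hy z hz
          · exact (T.le_opNorm _).trans (by gcongr)
      _ = _ := by ring
  linarith

/-! ### Averages over subsets of a fixed cardinality -/

theorem sum_powersetCard_succ_insert {ι : Type*} [DecidableEq ι] {s : Finset ι} {i : ι} (hi : i ∉ s)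
    (d : ℕ) (f : Finset ι → ℝ) :
    ∑ R ∈ (insert i s).powersetCard (d + 1), f R =
      ∑ R ∈ s.powersetCard (d + 1), f R + ∑ R ∈ s.powersetCard d, f (insert i R) := by
  rw [Finset.powersetCard_succ_insert hi, Finset.sum_union, Finset.sum_image]
  · intro R hR R' hR' h
    have h1 : i ∉ R := fun hmem => hi ((Finset.mem_powersetCard.1 hR).1 hmem)
    have h2 : i ∉ R' := fun hmem => hi ((Finset.mem_powersetCard.1 hR').1 hmem)
    rw [← Finset.erase_insert h1, ← Finset.erase_insert h2]
    exact congrArg (fun R => R.erase i) h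
  · rw [Finset.disjoint_left]
    intro R hR hR'
    obtain ⟨R', _, rfl⟩ := Finset.mem_image.1 hR'
    exact hi ((Finset.mem_powersetCard.1 hR).1 (Finset.mem_insert_self _ _))

/-- Adjoining a point `z` to `k` points of mean `σ` multiplies the mean by `1 + (z/σ - 1)/(k + 1)`.
The left side is affine in `z` and is exactly the Bernoulli lower bound for the `(d + 1)`-st power
of that factor. -/
theorem maclaurin_step {k z σ C c c' : ℝ} {d : ℕ} (hk : 0 < k) (hσ : 0 < σ) (hz : 0 < z)
    (hC : 0 ≤ C) (h1 : (k + 1) * c = C * (d + 1)) (h2 : C = c + c') :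
    c' * σ ^ (d + 1) + z * (c * σ ^ d) ≤ C * ((z + k * σ) / (k + 1)) ^ (d + 1) := by
  have hbern : 1 + ((d + 1 : ℕ) : ℝ) * ((z / σ - 1) / (k + 1)) ≤
      (1 + (z / σ - 1) / (k + 1)) ^ (d + 1) := by
    refine one_add_mul_le_pow ?_ _
    rw [le_div_iff₀ (by positivity)]
    have := div_pos hz hσ
    linarith
  have hr : (z + k * σ) / (k + 1) = σ * (1 + (z / σ - 1) / (k + 1)) := by
    field_simp; ring
  rw [hr, mul_pow]
  calc c' * σ ^ (d + 1) + z * (c * σ ^ d)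
      = C * (σ ^ (d + 1) * (1 + ((d + 1 : ℕ) : ℝ) * ((z / σ - 1) / (k + 1)))) := by
        have h3 : c' = C - c := by linarith
        have h4 : c = C * (d + 1) / (k + 1) := by
          rw [eq_div_iff (by positivity)]; linarith
        rw [h3, h4]
        push_cast
        field_simp
        ring
    _ ≤ _ := by gcongr

/-- **Maclaurin's inequality** between an elementary symmetric mean and the arithmetic mean. -/
theorem sum_powersetCard_prod_le {ι : Type*} [DecidableEq ι] (s : Finset ι) (z : ι → ℝ)
    (hz : ∀ i, 0 < z i) (d : ℕ) :
    ∑ R ∈ s.powersetCard d, ∏ i ∈ R, z i ≤ s.card.choose d * ((∑ i ∈ s, z i) / s.card) ^ d := by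
  have hE : ∀ d, (∅ : Finset ι).powersetCard (d + 1) = ∅ :=
    fun d => Finset.powersetCard_eq_empty.2 (by simp)
  induction s using Finset.induction_on generalizing d with
  | empty =>
    cases d with
    | zero => simp
    | succ d => simp [hE]
  | insert i s hi ih =>
    cases d with
    | zero => simp
    | succ d =>
      rw [sum_powersetCard_succ_insert hi, Finset.card_insert_of_notMem hi, Finset.sum_insert hi]
      have h2 : ∑ R ∈ s.powersetCard d, ∏ j ∈ insert i R, z j =
          z i * ∑ R ∈ s.powersetCard d, ∏ j ∈ R, z j := by
        rw [Finset.mul_sum]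
        refine Finset.sum_congr rfl fun R hR => Finset.prod_insert fun hmem => ?_
        exact hi ((Finset.mem_powersetCard.1 hR).1 hmem)
      rw [h2]
      have e1 := ih (d + 1)
      have e2 := mul_le_mul_of_nonneg_left (ih d) (hz i).le
      rcases s.eq_empty_or_nonempty with rfl | hs
      · cases d with
        | zero => simp [hE]
        | succ d =>
          have := (hz i).le
          simp only [hE, Finset.sum_empty, mul_zero, add_zero]
          positivity
      have hk : (0 : ℝ) < s.card := by exact_mod_cast hs.card_pos
      obtain ⟨σ, hσ⟩ : ∃ σ, σ = (∑ j ∈ s, z j) / s.card := ⟨_, rfl⟩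
      have hσ0 : 0 < σ := hσ ▸ div_pos (Finset.sum_pos (fun j _ => hz j) hs) hk
      have hsum : ∑ j ∈ s, z j = s.card * σ := by rw [hσ]; field_simp
      rw [← hσ] at e1 e2
      rw [hsum]
      refine (add_le_add e1 e2).trans ?_
      have hc1 : ((s.card : ℝ) + 1) * s.card.choose d =
          (s.card + 1).choose (d + 1) * (d + 1) := by
        exact_mod_cast Nat.add_one_mul_choose_eq s.card d
      have hc2 : ((s.card + 1).choose (d + 1) : ℝ) =
          s.card.choose d + s.card.choose (d + 1) := by
        exact_mod_cast Nat.choose_succ_succ s.card d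
      push_cast
      exact maclaurin_step hk hσ0 (hz i) (by positivity) hc1 hc2

/-- Maclaurin's inequality for the numbers `exp (a j)`, followed by `1 + x ≤ exp x` for the mean of
`exp (a j) - 1`. -/
theorem average_powersetCard_exp_le {n : ℕ} (hn : 1 ≤ n) (d : ℕ) (a : Fin n → ℝ) :
    ((n.choose d : ℝ))⁻¹ * ∑ R ∈ (Finset.univ : Finset (Fin n)).powersetCard d,
      Real.exp (∑ j ∈ R, a j) ≤ Real.exp (d / n * ∑ j, (Real.exp (a j) - 1)) := by
  have hn0 : (0 : ℝ) < n := by exact_mod_cast hn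
  have h := sum_powersetCard_prod_le (Finset.univ : Finset (Fin n)) (fun j => Real.exp (a j))
    (fun j => Real.exp_pos _) d
  simp_rw [← Real.exp_sum] at h
  rw [Finset.card_univ, Fintype.card_fin] at h
  have h1 : (∑ j, Real.exp (a j)) / n ≤ Real.exp ((∑ j, (Real.exp (a j) - 1)) / n) := by
    refine le_trans (le_of_eq ?_) (Real.add_one_le_exp _)
    rw [Finset.sum_sub_distrib]
    simp
    field_simp
    ring
  calc _ ≤ ((n.choose d : ℝ))⁻¹ * (n.choose d * ((∑ j, Real.exp (a j)) / n) ^ d) := by gcongr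
    _ ≤ ((∑ j, Real.exp (a j)) / n) ^ d := by
        rw [← mul_assoc]
        refine mul_le_of_le_one_left ?_ inv_mul_le_one
        have : 0 ≤ ∑ j, Real.exp (a j) := Finset.sum_nonneg fun j _ => (Real.exp_pos _).le
        positivity
    _ ≤ Real.exp ((∑ j, (Real.exp (a j) - 1)) / n) ^ d := by
        have : 0 ≤ ∑ j, Real.exp (a j) := Finset.sum_nonneg fun j _ => (Real.exp_pos _).le
        gcongr
    _ = _ := by rw [← Real.exp_nat_mul]; congr 1; ring

theorem average_powersetCard_mem {n d : ℕ} (hdn : d ≤ n) (j : Fin n) :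
    ((n.choose d : ℝ))⁻¹ * ∑ R ∈ (Finset.univ : Finset (Fin n)).powersetCard d,
      (if j ∈ R then (1 : ℝ) else 0) = d / n := by
  obtain ⟨k, rfl⟩ : ∃ k, n = k + 1 := ⟨n - 1, by have := j.pos; omega⟩
  cases d with
  | zero => simp
  | succ d =>
    have hc1 : ((k : ℝ) + 1) * k.choose d = (k + 1).choose (d + 1) * (d + 1) := by
      exact_mod_cast Nat.add_one_mul_choose_eq k d
    have hpos : (0 : ℝ) < (k + 1).choose (d + 1) := by exact_mod_cast Nat.choose_pos hdn
    rw [← Finset.insert_erase (Finset.mem_univ j),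
      sum_powersetCard_succ_insert (Finset.notMem_erase _ _)]
    have h1 : ∑ R ∈ (Finset.univ.erase j).powersetCard (d + 1), (if j ∈ R then (1 : ℝ) else 0) = 0 := by
      refine Finset.sum_eq_zero fun R hR => if_neg fun hmem => ?_
      exact Finset.notMem_erase j _ ((Finset.mem_powersetCard.1 hR).1 hmem)
    rw [h1]
    simp only [Finset.mem_insert_self, if_true, Finset.sum_const, Finset.card_powersetCard,
      Finset.card_erase_of_mem (Finset.mem_univ j), Finset.card_univ, Fintype.card_fin,
      nsmul_eq_mul, zero_add, mul_one, Nat.add_sub_cancel]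
    push_cast
    field_simp
    linarith

/-! ### The law of a row -/

theorem integral_uniformOn_finset {α : Type*} [MeasurableSpace α] [MeasurableSingletonClass α]
    (s : Finset α) (f : α → ℝ) :
    ∫ x, f x ∂(uniformOn (s : Set α)) = (s.card : ℝ)⁻¹ * ∑ x ∈ s, f x := by
  have h : ∫ x in (s : Set α), f x ∂Measure.count = ∑ x ∈ s, f x := by
    have hs : (s : Set α) = ⋃ x ∈ s, {x} := by ext; simp
    rw [hs, integral_biUnion_finset]
    · refine Finset.sum_congr rfl fun x _ => ?_
      rw [integral_singleton]
      simp [Measure.real]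
    · exact fun x _ => measurableSet_singleton x
    · intro x _ y _ hxy
      simpa using hxy
    · exact fun x _ => integrableOn_singleton (by simp)
        (by rw [Measure.count_singleton]; exact ENNReal.one_lt_top)
  rw [uniformOn, ProbabilityTheory.cond, integral_smul_measure, h, Measure.count_apply_finset]
  simp

/-- The indicator vector of a set of coordinates. -/
noncomputable def indicatorVector {n : ℕ} (R : Finset (Fin n)) : Fin n → ℝ :=
  fun j => if j ∈ R then 1 else 0

theorem indicatorVector_injective {n : ℕ} :
    Function.Injective (indicatorVector (n := n)) := by
  intro R R' h
  ext j
  have := congrFun h j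
  simp only [indicatorVector] at this
  by_cases h1 : j ∈ R <;> by_cases h2 : j ∈ R' <;> simp_all

theorem zeroOneVectors_eq (n d : ℕ) : zeroOneVectors n d =
    (((Finset.univ : Finset (Fin n)).powersetCard d).map
      ⟨indicatorVector, indicatorVector_injective⟩ : Finset (Fin n → ℝ)) := by
  classical
  ext v
  simp only [zeroOneVectors, Set.mem_ofPred_eq, Finset.coe_map, Function.Embedding.coeFn_mk,
    Set.mem_image, Finset.mem_coe, Finset.mem_powersetCard_univ]
  constructor
  · rintro ⟨h1, h2⟩
    refine ⟨Finset.univ.filter fun j => v j = 1, ?_, ?_⟩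
    · rw [← h2, Set.ncard_eq_toFinset_card']
      congr 1
      ext; simp
    · ext j
      rcases h1 j with h | h <;> simp [indicatorVector, h]
  · rintro ⟨R, hR, rfl⟩
    refine ⟨fun j => ?_, ?_⟩
    · by_cases h : j ∈ R <;> simp [indicatorVector, h]
    · have : {j | indicatorVector R j = 1} = (R : Set (Fin n)) := by
        ext j; by_cases h : j ∈ R <;> simp [indicatorVector, h]
      rw [this, Set.ncard_coe_finset, hR]

theorem integral_uniformOn_zeroOneVectors (n d : ℕ) (f : (Fin n → ℝ) → ℝ) :
    ∫ v, f v ∂(uniformOn (zeroOneVectors n d)) = (n.choose d : ℝ)⁻¹ *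
      ∑ R ∈ (Finset.univ : Finset (Fin n)).powersetCard d, f (indicatorVector R) := by
  rw [zeroOneVectors_eq, integral_uniformOn_finset, Finset.card_map, Finset.card_powersetCard,
    Finset.card_univ, Fintype.card_fin, Finset.sum_map]
  rfl

theorem sum_eq_of_mem_zeroOneVectors {n d : ℕ} {v : Fin n → ℝ} (hv : v ∈ zeroOneVectors n d) :
    ∑ j, v j = d := by
  rw [zeroOneVectors_eq] at hv
  obtain ⟨R, hR, rfl⟩ := Finset.mem_map.1 (Finset.mem_coe.1 hv)
  simp only [Function.Embedding.coeFn_mk, indicatorVector]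
  simp [(Finset.mem_powersetCard.1 hR).2]

/-- The consequences of the uniform row law that control the norm: a zero-one random matrix with
independent rows of sum `d` whose moment generating function is dominated by the one of a Poisson
matrix of intensity `d / n`. -/
structure IsPoissonDominated {Ω : Type*} [MeasurableSpace Ω] (P : Measure Ω) {m n : ℕ} (d : ℕ)
    (M : Ω → Matrix (Fin m) (Fin n) ℝ) : Prop where
  measurable_row : ∀ i : Fin m, Measurable (fun ω => M ω i)
  indep_rows : iIndepFun (fun (i : Fin m) (ω : Ω) => M ω i) P
  ae_mem : ∀ᵐ ω ∂P, ∀ i, M ω i ∈ zeroOneVectors n d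
  mgf_row : ∀ (i : Fin m) (a : Fin n → ℝ),
    ∫ ω, Real.exp (∑ j, a j * M ω i j) ∂P ≤ Real.exp (d / n * ∑ j, (Real.exp (a j) - 1))
  mean : ∀ i j, ∫ ω, M ω i j ∂P = d / n

section

variable {Ω : Type*} [MeasurableSpace Ω] {P : Measure Ω} {m n d : ℕ}
  {M : Ω → Matrix (Fin m) (Fin n) ℝ}

theorem IsRandomCombinatorial.integral_row (h : IsRandomCombinatorial P d M) (i : Fin m)
    {f : (Fin n → ℝ) → ℝ} (hf : Measurable f) :
    ∫ ω, f (M ω i) ∂P = (n.choose d : ℝ)⁻¹ *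
      ∑ R ∈ (Finset.univ : Finset (Fin n)).powersetCard d, f (indicatorVector R) := by
  rw [← integral_uniformOn_zeroOneVectors, ← h.law_row i,
    integral_map (h.measurable_row i).aemeasurable hf.aestronglyMeasurable]

theorem IsRandomCombinatorial.ae_mem (h : IsRandomCombinatorial P d M) :
    ∀ᵐ ω ∂P, ∀ i, M ω i ∈ zeroOneVectors n d := by
  rw [ae_all_iff]
  intro i
  have hms : MeasurableSet (zeroOneVectors n d) := by
    rw [zeroOneVectors_eq]; exact Finset.measurableSet _
  have : ∀ᵐ v ∂(P.map fun ω => M ω i), v ∈ zeroOneVectors n d := by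
    rw [h.law_row i]
    exact ae_cond_mem hms
  exact ae_of_ae_map (h.measurable_row i).aemeasurable this

theorem IsRandomCombinatorial.isPoissonDominated (h : IsRandomCombinatorial P d M) (hn : 1 ≤ n)
    (hdn : d ≤ n) : IsPoissonDominated P d M where
  measurable_row := h.measurable_row
  indep_rows := h.indep_rows
  ae_mem := h.ae_mem
  mgf_row i a := by
    rw [h.integral_row i (f := fun v => Real.exp (∑ j, a j * v j)) (by fun_prop)]
    refine le_trans (le_of_eq ?_) (average_powersetCard_exp_le hn d a)
    congr 1
    refine Finset.sum_congr rfl fun R _ => ?_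
    simp [indicatorVector]
  mean i j := by
    rw [h.integral_row i (f := fun v => v j) (by fun_prop), ← average_powersetCard_mem hdn j]
    rfl

theorem indicatorVector_compl (R : Finset (Fin n)) :
    (fun j => 1 - indicatorVector R j) = indicatorVector Rᶜ := by
  ext j
  by_cases h : j ∈ R <;> simp [indicatorVector, h]

/-- The complement of a combinatorial random matrix. -/
theorem IsRandomCombinatorial.isPoissonDominated_compl (h : IsRandomCombinatorial P d M)
    (hn : 1 ≤ n) (hdn : d ≤ n) :
    IsPoissonDominated P (n - d) (fun ω => Matrix.of fun i j => 1 - M ω i j) := by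
  have hrow : ∀ (i : Fin m) {f : (Fin n → ℝ) → ℝ}, Measurable f →
      ∫ ω, f (fun j => 1 - M ω i j) ∂P = (n.choose (n - d) : ℝ)⁻¹ *
        ∑ R ∈ (Finset.univ : Finset (Fin n)).powersetCard (n - d), f (indicatorVector R) := by
    intro i f hf
    rw [h.integral_row i (f := fun v => f fun j => 1 - v j) (by fun_prop), Nat.choose_symm hdn]
    congr 1
    simp_rw [indicatorVector_compl]
    refine Finset.sum_nbij' (fun R => Rᶜ) (fun R => Rᶜ) ?_ ?_ ?_ ?_ ?_
    · intro R hR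
      rw [Finset.mem_powersetCard_univ] at hR ⊢
      rw [Finset.card_compl, Fintype.card_fin, hR]
    · intro R hR
      rw [Finset.mem_powersetCard_univ] at hR ⊢
      rw [Finset.card_compl, Fintype.card_fin, hR]
      omega
    · simp
    · simp
    · simp
  refine ⟨fun i => ?_, ?_, ?_, fun i a => ?_, fun i j => ?_⟩
  · have := h.measurable_row i
    change Measurable fun ω j => 1 - M ω i j
    fun_prop
  · exact h.indep_rows.comp (fun _ v j => 1 - v j) (fun _ => by fun_prop)
  · filter_upwards [h.ae_mem] with ω hω i
    have := hω i
    rw [zeroOneVectors_eq] at this ⊢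
    obtain ⟨R, hR, hRi⟩ := Finset.mem_map.1 (Finset.mem_coe.1 this)
    refine Finset.mem_coe.2 (Finset.mem_map.2 ⟨Rᶜ, ?_, ?_⟩)
    · rw [Finset.mem_powersetCard_univ] at hR ⊢
      rw [Finset.card_compl, Fintype.card_fin, hR]
    · simp only [Function.Embedding.coeFn_mk] at hRi ⊢
      rw [← indicatorVector_compl, hRi]
      rfl
  · simp only [Matrix.of_apply]
    rw [hrow i (f := fun v => Real.exp (∑ j, a j * v j)) (by fun_prop)]
    refine le_trans (le_of_eq ?_) (average_powersetCard_exp_le hn (n - d) a)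
    congr 1
    refine Finset.sum_congr rfl fun R _ => ?_
    simp [indicatorVector]
  · simp only [Matrix.of_apply]
    rw [hrow i (f := fun v => v j) (by fun_prop),
      ← average_powersetCard_mem (Nat.sub_le n d) j]
    rfl

/-! ### Exponential moments of linear statistics -/

theorem IsPoissonDominated.integrable_exp [IsProbabilityMeasure P] (h : IsPoissonDominated P d M)
    (a : Fin m → Fin n → ℝ) :
    Integrable (fun ω => Real.exp (∑ i, ∑ j, a i j * M ω i j)) P := by
  refine Integrable.of_bound (C := Real.exp (∑ i, ∑ j, |a i j|)) ?_ ?_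
  · have := h.measurable_row
    apply Measurable.aestronglyMeasurable
    fun_prop
  · filter_upwards [h.ae_mem] with ω hω
    rw [Real.norm_eq_abs, Real.abs_exp, Real.exp_le_exp]
    refine Finset.sum_le_sum fun i _ => Finset.sum_le_sum fun j _ => ?_
    rcases (hω i).1 j with h | h
    · rw [h, mul_zero]; positivity
    · rw [h, mul_one]; exact le_abs_self _

theorem IsPoissonDominated.integral_exp_le [IsProbabilityMeasure P] (h : IsPoissonDominated P d M)
    (a : Fin m → Fin n → ℝ) :
    ∫ ω, Real.exp (∑ i, ∑ j, a i j * M ω i j) ∂P ≤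
      Real.exp (d / n * ∑ i, ∑ j, (Real.exp (a i j) - 1)) := by
  have hind : iIndepFun (fun (i : Fin m) (ω : Ω) => ∑ j, a i j * M ω i j) P :=
    h.indep_rows.comp (fun i v => ∑ j, a i j * v j) (fun i => by fun_prop)
  have hmeas : ∀ i, Measurable fun ω => ∑ j, a i j * M ω i j := fun i => by
    have := h.measurable_row i
    fun_prop
  have := hind.mgf_sum (t := 1) hmeas Finset.univ
  simp only [mgf, one_mul, Finset.sum_apply] at this
  rw [this, Finset.mul_sum, Real.exp_sum]
  exact Finset.prod_le_prod (fun i _ => integral_nonneg fun ω => (Real.exp_pos _).le)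
    fun i _ => h.mgf_row i (a i)

/-- Chernoff's bound for linear statistics. -/
theorem IsPoissonDominated.chernoff [IsProbabilityMeasure P] (h : IsPoissonDominated P d M)
    (a : Fin m → Fin n → ℝ) (t : ℝ) :
    P.real {ω | t < ∑ i, ∑ j, a i j * M ω i j} ≤
      Real.exp (d / n * ∑ i, ∑ j, (Real.exp (a i j) - 1) - t) := by
  have h1 := measure_ge_le_exp_mul_mgf (μ := P) (X := fun ω => ∑ i, ∑ j, a i j * M ω i j) t
    zero_le_one (by simpa using h.integrable_exp a)
  simp only [mgf, one_mul] at h1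
  calc P.real {ω | t < ∑ i, ∑ j, a i j * M ω i j}
      ≤ P.real {ω | t ≤ ∑ i, ∑ j, a i j * M ω i j} :=
        measureReal_mono fun ω hω => by
          rw [Set.mem_ofPred_eq] at hω ⊢; exact hω.le
    _ ≤ Real.exp (-1 * t) * Real.exp (d / n * ∑ i, ∑ j, (Real.exp (a i j) - 1)) :=
        h1.trans (by gcongr; exact h.integral_exp_le a)
    _ = _ := by rw [← Real.exp_add]; congr 1; ring

end

/-! ### Entropy of subsets -/

/-- The usual bound `(e n / t)^t`, from `n.choose t ≤ n^t / t!` and `t^t / t! ≤ e^t`. -/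
theorem choose_le_exp_subsetEntropy {n t : ℕ} (ht : 1 ≤ t) (hn : 1 ≤ n) :
    (n.choose t : ℝ) ≤ Real.exp (subsetEntropy n t) := by
  have ht0 : (0 : ℝ) < t := by exact_mod_cast ht
  have hn0 : (0 : ℝ) < n := by exact_mod_cast hn
  have h1 : (n.choose t : ℝ) ≤ (n : ℝ) ^ t / t.factorial := Nat.choose_le_pow_div t n
  have h2 := Real.pow_div_factorial_le_exp (t : ℝ) ht0.le t
  have h3 : Real.exp (subsetEntropy n t) = Real.exp t * ((n : ℝ) / t) ^ t := by
    rw [subsetEntropy, mul_add, mul_one, Real.exp_add, Real.exp_nat_mul,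
      Real.exp_log (by positivity)]
  calc (n.choose t : ℝ) ≤ (n : ℝ) ^ t / t.factorial := h1
    _ = (t : ℝ) ^ t / t.factorial * ((n : ℝ) / t) ^ t := by
        rw [div_pow]
        field_simp
    _ ≤ Real.exp t * ((n : ℝ) / t) ^ t := by gcongr
    _ = _ := h3.symm

theorem subsetEntropy_mono {n s t : ℝ} (hs : 0 < s) (hst : s ≤ t) (htn : t ≤ n) :
    subsetEntropy n s ≤ subsetEntropy n t := by
  have ht : 0 < t := hs.trans_le hst
  have hn : 0 < n := ht.trans_le htn
  have h1 : Real.log (n / s) = Real.log (n / t) + Real.log (t / s) := by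
    rw [← Real.log_mul (by positivity) (by positivity)]
    congr 1
    field_simp
  have h2 : s * Real.log (t / s) ≤ t - s := by
    have := Real.log_le_sub_one_of_pos (div_pos ht hs)
    calc s * Real.log (t / s) ≤ s * (t / s - 1) := by gcongr
      _ = t - s := by field_simp
  have h3 : 0 ≤ Real.log (n / t) := Real.log_nonneg ((one_le_div ht).2 htn)
  unfold subsetEntropy
  rw [h1]
  nlinarith

/-- The entropy dominates the log of the number of sets of each size, so each nonzero cardinality
contributes at most 1. -/
theorem sum_exp_neg_subsetEntropy_le {m n : ℕ} (hn : 1 ≤ n) (hmn : m ≤ n) :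
    ∑ S : Finset (Fin m), (if S.card = 0 then 0 else Real.exp (-subsetEntropy n S.card)) ≤ n := by
  have := Finset.sum_powerset_apply_card
    (fun k : ℕ => if k = 0 then (0 : ℝ) else Real.exp (-subsetEntropy n k))
    (x := (Finset.univ : Finset (Fin m)))
  rw [Finset.powerset_univ] at this
  rw [this, Finset.card_univ, Fintype.card_fin, Finset.sum_range_succ']
  simp only [if_true, smul_zero, add_zero, Nat.add_eq_zero_iff, one_ne_zero, and_false, if_false]
  calc ∑ k ∈ Finset.range m, m.choose (k + 1) • Real.exp (-subsetEntropy n ((k + 1 : ℕ) : ℝ))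
      ≤ ∑ k ∈ Finset.range m, (1 : ℝ) := by
        refine Finset.sum_le_sum fun k _ => ?_
        rw [nsmul_eq_mul, Real.exp_neg, ← div_eq_mul_inv, div_le_one (Real.exp_pos _)]
        refine le_trans ?_ (choose_le_exp_subsetEntropy (Nat.succ_pos k) hn)
        exact_mod_cast Nat.choose_le_choose _ hmn
    _ ≤ n := by simpa using hmn

section

variable {Ω : Type*} [MeasurableSpace Ω] {P : Measure Ω} [IsProbabilityMeasure P] {m n d : ℕ}
  {M : Ω → Matrix (Fin m) (Fin n) ℝ}

/-! ### The exceptional events -/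

/-- Chernoff with exponent 1: the moment costs at most `2d ≤ 2c²/9`, so more than `c²/2 ≥ γ log m`
remains. -/
theorem IsPoissonDominated.prob_column_le (h : IsPoissonDominated P d M) (hm : 1 ≤ m)
    (hmn : m ≤ n) {c γ : ℝ} (hd : 9 * (d : ℝ) ≤ c ^ 2) (hγ : 2 * γ * Real.log m ≤ c ^ 2) :
    P.real {ω | ∃ j, c ^ 2 < ∑ i, M ω i j} ≤ n * (m : ℝ) ^ (-γ) := by
  have hm0 : (0 : ℝ) < m := by exact_mod_cast hm
  have hmn' : (m : ℝ) ≤ n := by exact_mod_cast hmn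
  have hn0 : (0 : ℝ) < n := hm0.trans_le hmn'
  have key : ∀ j : Fin n, P.real {ω | c ^ 2 < ∑ i, M ω i j} ≤ (m : ℝ) ^ (-γ) := by
    intro j
    have h1 := h.chernoff (fun _ j' => if j' = j then 1 else 0) (c ^ 2)
    have h2 : ∀ j', Real.exp (if j' = j then (1 : ℝ) else 0) - 1 =
        if j' = j then Real.exp 1 - 1 else 0 := by
      intro j'; split_ifs <;> simp
    simp only [ite_mul, one_mul, zero_mul, Finset.sum_ite_eq', Finset.mem_univ, if_true, h2,
      Finset.sum_const, Finset.card_univ, Fintype.card_fin, nsmul_eq_mul] at h1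
    refine h1.trans ?_
    rw [Real.rpow_def_of_pos hm0, Real.exp_le_exp]
    have he : Real.exp 1 - 1 ≤ 2 := by linarith [Real.exp_one_lt_d9]
    have he0 : 0 ≤ Real.exp 1 - 1 := by linarith [Real.add_one_le_exp 1]
    have hd0 : (0 : ℝ) ≤ d := by positivity
    have : (d : ℝ) / n * (m * (Real.exp 1 - 1)) ≤ 2 * d := by
      calc (d : ℝ) / n * (m * (Real.exp 1 - 1)) ≤ d / n * (n * 2) := by gcongr
        _ = 2 * d := by field_simp
    linarith
  calc P.real {ω | ∃ j, c ^ 2 < ∑ i, M ω i j}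
      = P.real (⋃ j ∈ (Finset.univ : Finset (Fin n)), {ω | c ^ 2 < ∑ i, M ω i j}) := by
        congr 1; ext ω; simp
    _ ≤ ∑ j, P.real {ω | c ^ 2 < ∑ i, M ω i j} :=
        measureReal_biUnion_finset_le Finset.univ fun j => {ω | c ^ 2 < ∑ i, M ω i j}
    _ ≤ ∑ _j : Fin n, (m : ℝ) ^ (-γ) := Finset.sum_le_sum fun j _ => key j
    _ = _ := by simp

theorem IsPoissonDominated.prob_edges_le (h : IsPoissonDominated P d M) {c t : ℝ}
    (hd : (d : ℝ) ≤ c ^ 2) (S : Finset (Fin m)) (T : Finset (Fin n)) (a : ℕ) :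
    P.real {ω | c ^ 2 * S.card * T.card / n * Real.exp a + t <
      a * ∑ i ∈ S, ∑ j ∈ T, M ω i j} ≤ Real.exp (-t) := by
  have h1 := h.chernoff (fun i j => if i ∈ S then if j ∈ T then (a : ℝ) else 0 else 0)
    (c ^ 2 * S.card * T.card / n * Real.exp a + t)
  have h2 : ∀ i j, Real.exp (if i ∈ S then if j ∈ T then (a : ℝ) else 0 else 0) - 1 =
      if i ∈ S then if j ∈ T then Real.exp a - 1 else 0 else 0 := by
    intro i j; split_ifs <;> simp
  have h3 : ∀ ω, ∑ i, ∑ j, (if i ∈ S then if j ∈ T then (a : ℝ) else 0 else 0) * M ω i j =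
      a * ∑ i ∈ S, ∑ j ∈ T, M ω i j := by
    intro ω
    simp only [ite_mul, zero_mul]
    simp [Finset.sum_ite_mem, Finset.mul_sum]
  have h4 : ∑ i : Fin m, ∑ j : Fin n,
      (if i ∈ S then if j ∈ T then Real.exp a - 1 else 0 else 0) =
      S.card * (T.card * (Real.exp a - 1)) := by
    simp [Finset.sum_ite_mem]
    ring
  simp only [h2, h3, h4] at h1
  refine h1.trans (Real.exp_le_exp.2 ?_)
  have : (d : ℝ) / n * (S.card * (T.card * (Real.exp a - 1))) ≤
      c ^ 2 / n * (S.card * (T.card * Real.exp a)) := by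
    have he : 0 ≤ Real.exp a - 1 := sub_nonneg.2 (Real.one_le_exp (by positivity))
    calc (d : ℝ) / n * (S.card * (T.card * (Real.exp a - 1)))
        ≤ c ^ 2 / n * (S.card * (T.card * (Real.exp a - 1))) :=
          mul_le_mul_of_nonneg_right (by gcongr) (by positivity)
      _ ≤ _ := by gcongr; linarith
  have h5 : c ^ 2 / n * (S.card * (T.card * Real.exp a)) =
      c ^ 2 * S.card * T.card / n * Real.exp a := by ring
  linarith

/-- Union bound over `S`, `T` and `a`. Of the `6β` entropies, two pay for choosing `S` and `T` of
given sizes. The others are each at least `1 + log n`: three pay for the sizes and for `a`, and `6β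
- 5 ≥ β` give the probability. -/
theorem IsPoissonDominated.prob_discrepancy_le (h : IsPoissonDominated P d M) (hn : 1 ≤ n)
    (hmn : m ≤ n) {c β : ℝ} (hd : (d : ℝ) ≤ c ^ 2) (hβ : 1 ≤ β) :
    P.real {ω | ¬ HasDiscrepancy (M ω) n c (6 * β)} ≤ (n : ℝ) ^ (-β) := by
  have hn1 : (1 : ℝ) ≤ n := by exact_mod_cast hn
  have hn0 : (0 : ℝ) < n := by linarith
  have hlog : 0 ≤ Real.log n := Real.log_nonneg hn1
  let f : ∀ {k : ℕ}, Finset (Fin k) → ℝ := fun S =>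
    if S.card = 0 then 0 else Real.exp (-subsetEntropy n S.card)
  let E : Finset (Fin m) × Finset (Fin n) × ℕ → Set Ω := fun p =>
    {ω | (p.1.Nonempty ∧ p.2.1.Nonempty) ∧
      c ^ 2 * p.1.card * p.2.1.card / n * Real.exp p.2.2 +
        6 * β * subsetEntropy n (max p.1.card p.2.1.card : ℕ) <
        p.2.2 * ∑ i ∈ p.1, ∑ j ∈ p.2.1, M ω i j}
  have key : ∀ p, P.real (E p) ≤
      f p.1 * f p.2.1 * Real.exp (-((6 * β - 2) * (1 + Real.log n))) := by
    rintro ⟨S, T, a⟩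
    by_cases hST : S.Nonempty ∧ T.Nonempty
    · have hS := hST.1.card_pos
      have hT := hST.2.card_pos
      have hSn : S.card ≤ n := (Finset.card_le_univ S).trans (by simpa using hmn)
      have hTn : T.card ≤ n := (Finset.card_le_univ T).trans (by simp)
      have hmaxn : ((max S.card T.card : ℕ) : ℝ) ≤ n := by exact_mod_cast max_le hSn hTn
      have g1 : subsetEntropy n S.card ≤ subsetEntropy n (max S.card T.card : ℕ) :=
        subsetEntropy_mono (by exact_mod_cast hS) (by exact_mod_cast le_max_left _ _) hmaxn
      have g2 : subsetEntropy n T.card ≤ subsetEntropy n (max S.card T.card : ℕ) :=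
        subsetEntropy_mono (by exact_mod_cast hT) (by exact_mod_cast le_max_right _ _) hmaxn
      have g3 : 1 + Real.log n ≤ subsetEntropy n (max S.card T.card : ℕ) := by
        have := subsetEntropy_mono (n := n) (s := 1) (t := (max S.card T.card : ℕ)) one_pos
          (by exact_mod_cast hS.trans_le (le_max_left _ _)) hmaxn
        simpa [subsetEntropy] using this
      have hE : E (S, T, a) ⊆ {ω | c ^ 2 * S.card * T.card / n * Real.exp a +
          6 * β * subsetEntropy n (max S.card T.card : ℕ) < a * ∑ i ∈ S, ∑ j ∈ T, M ω i j} :=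
        fun ω hω => hω.2
      refine (measureReal_mono hE).trans ((h.prob_edges_le hd S T a).trans ?_)
      simp only [f, hS.ne', hT.ne', if_false]
      rw [← Real.exp_add, ← Real.exp_add, Real.exp_le_exp]
      have := mul_le_mul_of_nonneg_left g3 (by linarith : 0 ≤ 6 * β - 2)
      nlinarith
    · have : E (S, T, a) = ∅ := by
        ext ω; simp only [E, Set.mem_ofPred_eq, Set.mem_empty_iff_false, iff_false]
        exact fun h => hST h.1
      rw [this]
      simp only [f, measureReal_empty]
      split_ifs <;> positivity
  have hsub : {ω | ¬ HasDiscrepancy (M ω) n c (6 * β)} ⊆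
      ⋃ p ∈ (Finset.univ ×ˢ Finset.univ ×ˢ Finset.range (n + 3) :
        Finset (Finset (Fin m) × Finset (Fin n) × ℕ)), E p := by
    intro ω hω
    simp only [HasDiscrepancy, Set.mem_ofPred_eq] at hω
    push Not at hω
    obtain ⟨S, T, hS, hT, a, _, han, hlt⟩ := hω
    have : a < n + 3 := by
      have : (a : ℝ) < (n + 3 : ℕ) := by push_cast; linarith
      exact_mod_cast this
    refine Set.mem_biUnion (x := (S, T, a)) ?_ ⟨⟨hS, hT⟩, hlt⟩
    simpa using this
  have hS := sum_exp_neg_subsetEntropy_le hn hmn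
  have hT := sum_exp_neg_subsetEntropy_le hn le_rfl
  have hS0 : (0 : ℝ) ≤ ∑ S : Finset (Fin m), f S :=
    Finset.sum_nonneg fun S _ => by simp only [f]; split_ifs <;> positivity
  have hT0 : (0 : ℝ) ≤ ∑ S : Finset (Fin n), f S :=
    Finset.sum_nonneg fun S _ => by simp only [f]; split_ifs <;> positivity
  calc P.real {ω | ¬ HasDiscrepancy (M ω) n c (6 * β)}
      ≤ _ := measureReal_mono hsub (measure_ne_top _ _)
    _ ≤ _ := measureReal_biUnion_finset_le _ _
    _ ≤ ∑ p ∈ (Finset.univ ×ˢ Finset.univ ×ˢ Finset.range (n + 3) :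
        Finset (Finset (Fin m) × Finset (Fin n) × ℕ)),
        f p.1 * f p.2.1 * Real.exp (-((6 * β - 2) * (1 + Real.log n))) :=
        Finset.sum_le_sum fun p _ => key p
    _ = (∑ S : Finset (Fin m), f S) * (∑ T : Finset (Fin n), f T) *
        ((n + 3 : ℕ) * Real.exp (-((6 * β - 2) * (1 + Real.log n)))) := by
        rw [Finset.sum_product, Finset.sum_mul_sum, Finset.sum_mul]
        refine Finset.sum_congr rfl fun S _ => ?_
        rw [Finset.sum_product, Finset.sum_mul]
        refine Finset.sum_congr rfl fun T _ => ?_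
        simp only [Finset.sum_const, Finset.card_range, nsmul_eq_mul]
        ring
    _ ≤ n * n * ((n + 3 : ℕ) * Real.exp (-((6 * β - 2) * (1 + Real.log n)))) := by
        gcongr
    _ ≤ Real.exp (3 * (1 + Real.log n)) * Real.exp (-((6 * β - 2) * (1 + Real.log n))) := by
        rw [← mul_assoc]
        gcongr
        have he : (2 : ℝ) ≤ Real.exp 1 := by linarith [Real.add_one_le_exp 1]
        have : Real.exp (3 * (1 + Real.log n)) = Real.exp 1 ^ 3 * (n : ℝ) ^ 3 := by
          rw [← mul_pow, mul_comm (3 : ℝ), Real.exp_mul, Real.exp_add, Real.exp_log hn0]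
          norm_cast
        rw [this]
        have h8 : (8 : ℝ) ≤ Real.exp 1 ^ 3 := by
          calc (8 : ℝ) = 2 ^ 3 := by norm_num
            _ ≤ _ := by gcongr
        calc (n : ℝ) * n * (n + 3 : ℕ) ≤ n * n * (8 * n) := by
              gcongr; push_cast; linarith
          _ = 8 * (n : ℝ) ^ 3 := by ring
          _ ≤ _ := by gcongr
    _ ≤ (n : ℝ) ^ (-β) := by
        rw [← Real.exp_add, Real.rpow_def_of_pos hn0, Real.exp_le_exp]
        nlinarith

/-- The part of the centered bilinear form carried by the light couples. -/
noncomputable def lightForm {m n : ℕ} (θ p : ℝ) (A : Matrix (Fin m) (Fin n) ℝ) (x : Fin m → ℝ)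
    (y : Fin n → ℝ) : ℝ :=
  ∑ i, ∑ j, (if |x i * y j| ≤ θ then x i * y j else 0) * (A i j - p)

/-- Chernoff at scale `n / c`: the exponents have modulus at most 1, so `exp a - 1 ≤ a + a²`. The
linear part cancels the centering, and the quadratic part is at most `(d / n)(n / c)² ≤ n`. -/
theorem IsPoissonDominated.prob_lightForm_le (h : IsPoissonDominated P d M) (hn : 1 ≤ n) {c β : ℝ}
    (hc : 0 < c) (hd : (d : ℝ) ≤ c ^ 2) {x : Fin m → ℝ} {y : Fin n → ℝ}
    (hx : ∑ i, x i ^ 2 ≤ 1) (hy : ∑ j, y j ^ 2 ≤ 1) :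
    P.real {ω | 7 * β * c < lightForm (c / n) (d / n) (M ω) x y} ≤ Real.exp (n - 7 * β * n) := by
  have hn0 : (0 : ℝ) < n := by exact_mod_cast hn
  set a : Fin m → Fin n → ℝ := fun i j =>
    n / c * (if |x i * y j| ≤ c / n then x i * y j else 0) with ha
  have ha1 : ∀ i j, |a i j| ≤ 1 := by
    intro i j
    simp only [ha]
    split_ifs with hle
    · rw [abs_mul, abs_of_pos (by positivity : 0 < (n : ℝ) / c)]
      calc (n : ℝ) / c * |x i * y j| ≤ n / c * (c / n) := by gcongr
        _ = 1 := by field_simp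
    · simp
  have ha2 : ∀ i j, a i j ^ 2 ≤ (n / c) ^ 2 * (x i ^ 2 * y j ^ 2) := by
    intro i j
    simp only [ha]
    split_ifs with hle
    · exact le_of_eq (by ring)
    · simp only [mul_zero, ne_eq, OfNat.ofNat_ne_zero, not_false_eq_true, zero_pow]
      positivity
  have hsq : ∑ i, ∑ j, a i j ^ 2 ≤ (n / c) ^ 2 := by
    calc ∑ i, ∑ j, a i j ^ 2 ≤ ∑ i, ∑ j, (n / c) ^ 2 * (x i ^ 2 * y j ^ 2) :=
          Finset.sum_le_sum fun i _ => Finset.sum_le_sum fun j _ => ha2 i j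
      _ = (n / c) ^ 2 * ((∑ i, x i ^ 2) * ∑ j, y j ^ 2) := by
          rw [Finset.sum_mul_sum, Finset.mul_sum]
          simp_rw [Finset.mul_sum]
      _ ≤ (n / c) ^ 2 * (1 * 1) := by
          have : 0 ≤ ∑ j, y j ^ 2 := Finset.sum_nonneg fun j _ => sq_nonneg _
          gcongr
      _ = _ := by ring
  have hform : ∀ ω, n / c * lightForm (c / n) (d / n) (M ω) x y =
      ∑ i, ∑ j, a i j * M ω i j - d / n * ∑ i, ∑ j, a i j := by
    intro ω
    simp only [lightForm, Finset.mul_sum, ← Finset.sum_sub_distrib, ha]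
    exact Finset.sum_congr rfl fun i _ => Finset.sum_congr rfl fun j _ => by ring
  have hset : {ω | 7 * β * c < lightForm (c / n) (d / n) (M ω) x y} ⊆
      {ω | 7 * β * n + d / n * ∑ i, ∑ j, a i j < ∑ i, ∑ j, a i j * M ω i j} := by
    intro ω hω
    rw [Set.mem_ofPred_eq] at hω ⊢
    have h1 := mul_lt_mul_of_pos_left hω (by positivity : 0 < (n : ℝ) / c)
    rw [hform ω] at h1
    have h2 : (n : ℝ) / c * (7 * β * c) = 7 * β * n := by field_simp
    linarith
  refine (measureReal_mono hset).trans ((h.chernoff a _).trans (Real.exp_le_exp.2 ?_))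
  have h3 : ∑ i, ∑ j, (Real.exp (a i j) - 1) ≤ ∑ i, ∑ j, a i j + ∑ i, ∑ j, a i j ^ 2 := by
    simp only [← Finset.sum_add_distrib]
    refine Finset.sum_le_sum fun i _ => Finset.sum_le_sum fun j _ => ?_
    linarith [(abs_le.1 (Real.abs_exp_sub_one_sub_id_le (ha1 i j))).2]
  have h4 : (d : ℝ) / n * ∑ i, ∑ j, (Real.exp (a i j) - 1) ≤
      d / n * ∑ i, ∑ j, a i j + n := by
    calc (d : ℝ) / n * ∑ i, ∑ j, (Real.exp (a i j) - 1)
        ≤ d / n * (∑ i, ∑ j, a i j + (n / c) ^ 2) := by gcongr; linarith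
      _ = d / n * ∑ i, ∑ j, a i j + d / c ^ 2 * n := by field_simp
      _ ≤ d / n * ∑ i, ∑ j, a i j + 1 * n := by
          gcongr
          exact (div_le_one (by positivity)).2 hd
      _ = _ := by ring
  linarith

theorem IsPoissonDominated.prob_net_le (h : IsPoissonDominated P d M) (hn : 1 ≤ n) (hmn : m ≤ n)
    {c β : ℝ} (hc : 0 < c) (hd : (d : ℝ) ≤ c ^ 2) (hβ : 1 ≤ β)
    {s : Finset (EuclideanSpace ℝ (Fin m))} {r : Finset (EuclideanSpace ℝ (Fin n))}
    (hs : s.card ≤ 5 ^ m) (hr : r.card ≤ 5 ^ n) (hs1 : ∀ x ∈ s, ‖x‖ ≤ 1)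
    (hr1 : ∀ y ∈ r, ‖y‖ ≤ 1) :
    P.real {ω | ∃ x ∈ s, ∃ y ∈ r, 7 * β * c < lightForm (c / n) (d / n) (M ω) x y} ≤
      (n : ℝ) ^ (-β) := by
  have hn0 : (0 : ℝ) < n := by exact_mod_cast hn
  have hsq : ∀ {k : ℕ} (x : EuclideanSpace ℝ (Fin k)), ‖x‖ ≤ 1 → ∑ i, x i ^ 2 ≤ 1 := by
    intro k x hx
    rw [← EuclideanSpace.real_norm_sq_eq]
    exact pow_le_one₀ (norm_nonneg _) hx
  calc P.real {ω | ∃ x ∈ s, ∃ y ∈ r, 7 * β * c < lightForm (c / n) (d / n) (M ω) x y}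
      = P.real (⋃ p ∈ s ×ˢ r, {ω | 7 * β * c < lightForm (c / n) (d / n) (M ω) p.1 p.2}) := by
        congr 1; ext ω; simp; tauto
    _ ≤ ∑ p ∈ s ×ˢ r, P.real {ω | 7 * β * c < lightForm (c / n) (d / n) (M ω) p.1 p.2} :=
        measureReal_biUnion_finset_le _ _
    _ ≤ ∑ p ∈ s ×ˢ r, Real.exp (n - 7 * β * n) := by
        refine Finset.sum_le_sum fun p hp => ?_
        obtain ⟨h1, h2⟩ := Finset.mem_product.1 hp
        exact h.prob_lightForm_le hn hc hd (hsq _ (hs1 _ h1)) (hsq _ (hr1 _ h2))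
    _ = s.card * r.card * Real.exp (n - 7 * β * n) := by
        rw [Finset.sum_const, Finset.card_product, nsmul_eq_mul]; push_cast; ring
    _ ≤ 5 ^ n * 5 ^ n * Real.exp (n - 7 * β * n) := by
        gcongr
        · calc (s.card : ℝ) ≤ 5 ^ m := by exact_mod_cast hs
            _ ≤ 5 ^ n := pow_le_pow_right₀ (by norm_num) hmn
        · exact_mod_cast hr
    -- Since `5 ≤ e²`, the nets cost `4n`; the exponent `5n - 7βn` is then at most `-2βn`.
    _ ≤ Real.exp (2 * n) * Real.exp (2 * n) * Real.exp (n - 7 * β * n) := by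
        have : (5 : ℝ) ^ n ≤ Real.exp (2 * n) := by
          rw [mul_comm, Real.exp_nat_mul]
          gcongr
          have : Real.exp 2 = Real.exp 1 ^ 2 := by rw [← Real.exp_nat_mul]; norm_num
          rw [this]
          nlinarith [Real.exp_one_gt_d9]
        gcongr
    _ ≤ (n : ℝ) ^ (-β) := by
        rw [← Real.exp_add, ← Real.exp_add, Real.rpow_def_of_pos hn0, Real.exp_le_exp]
        have := Real.log_le_self hn0.le
        nlinarith

end

/-! ### The norm of the centered matrix -/

theorem bilinear_sub_le_of_light {m n : ℕ} (hn : 1 ≤ n) (hmn : m ≤ n) {c p B t : ℝ} (hc : 1 ≤ c)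
    (hB : 0 ≤ B) (hp : 0 ≤ p) (hpc : p * n ≤ c ^ 2) {A : Matrix (Fin m) (Fin n) ℝ}
    (hA : ∀ i j, 0 ≤ A i j) (hrow : ∀ i, ∑ j, A i j ≤ c ^ 2) (hcol : ∀ j, ∑ i, A i j ≤ c ^ 2)
    (hdisc : HasDiscrepancy A n c B) {x : Fin m → ℝ} {y : Fin n → ℝ} (hx : ∑ i, x i ^ 2 ≤ 1)
    (hy : ∑ j, y j ^ 2 ≤ 1) (hlight : lightForm (c / n) p A x y ≤ t) :
    ∑ i, ∑ j, x i * y j * (A i j - p) ≤ t + 2 * ((136 + 80 * B) * c) + c := by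
  have hn0 : (0 : ℝ) < n := by exact_mod_cast hn
  have hc0 : 0 < c := by linarith
  have h1 := sum_heavy_le hA (by exact_mod_cast hn) hc hB (by simpa using hmn) (by simp) hrow hcol
    hdisc hx hy
  have h2 : ∑ i, ∑ j, n / c * p * (x i ^ 2 * y j ^ 2) ≤ c := by
    calc ∑ i, ∑ j, n / c * p * (x i ^ 2 * y j ^ 2)
        = n / c * p * ((∑ i, x i ^ 2) * ∑ j, y j ^ 2) := by
          rw [Finset.sum_mul_sum, Finset.mul_sum]
          simp_rw [Finset.mul_sum]
      _ ≤ n / c * p * (1 * 1) := by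
          have : 0 ≤ ∑ j, y j ^ 2 := Finset.sum_nonneg fun j _ => sq_nonneg _
          gcongr
      _ = p * n / c := by ring
      _ ≤ c := by rw [div_le_iff₀ hc0]; linarith
  have h3 : ∑ i, ∑ j, x i * y j * (A i j - p) ≤ lightForm (c / n) p A x y +
      ∑ i, ∑ j, (if c / n < |x i * y j| then |x i * y j| * A i j else 0) +
      ∑ i, ∑ j, n / c * p * (x i ^ 2 * y j ^ 2) := by
    simp only [lightForm, ← Finset.sum_add_distrib]
    refine Finset.sum_le_sum fun i _ => Finset.sum_le_sum fun j _ => ?_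
    have hz : n / c * p * (x i ^ 2 * y j ^ 2) = n / c * p * |x i * y j| ^ 2 := by
      rw [sq_abs]; ring
    rw [hz]
    by_cases h : |x i * y j| ≤ c / n
    · rw [if_pos h, if_neg (not_lt.2 h), add_zero]
      have : 0 ≤ n / c * p * |x i * y j| ^ 2 := by positivity
      linarith
    · rw [if_neg h, if_pos (not_le.1 h), zero_mul, zero_add]
      -- On a heavy couple this factor can be inserted into the mean term, turning it into a square
      -- that is summable over all couples.
      have h4 : 1 ≤ n / c * |x i * y j| := by
        have := (not_le.1 h).le
        rw [div_le_iff₀ hn0] at this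
        rw [div_mul_eq_mul_div, le_div_iff₀ hc0]
        linarith
      have h5 := abs_nonneg (x i * y j)
      have h6 : x i * y j * A i j ≤ |x i * y j| * A i j :=
        mul_le_mul_of_nonneg_right (le_abs_self _) (hA i j)
      have h7 : -(x i * y j * p) ≤ |x i * y j| * p := by
        rw [← neg_mul]
        exact mul_le_mul_of_nonneg_right (neg_le_abs _) hp
      have h8 : |x i * y j| * p ≤ n / c * p * |x i * y j| ^ 2 := by
        calc |x i * y j| * p = 1 * (|x i * y j| * p) := (one_mul _).symm
          _ ≤ n / c * |x i * y j| * (|x i * y j| * p) := by gcongr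
          _ = _ := by ring
      linarith
  linarith

theorem IsPoissonDominated.expectedMatrix_eq {Ω : Type*} [MeasurableSpace Ω] {P : Measure Ω}
    {m n d : ℕ} {M : Ω → Matrix (Fin m) (Fin n) ℝ} (h : IsPoissonDominated P d M) :
    expectedMatrix P M = Matrix.of fun _ _ => (d : ℝ) / n := by
  ext i j
  exact h.mean i j

section

variable {Ω : Type*} [MeasurableSpace Ω] {P : Measure Ω} [IsProbabilityMeasure P] {m n d : ℕ}
  {M : Ω → Matrix (Fin m) (Fin n) ℝ}

theorem IsPoissonDominated.norm_sub_expectedMatrix_le (h : IsPoissonDominated P d M) (hm : 1 ≤ m)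
    (hmn : m ≤ n) {N γ β : ℝ} (hβ : 1 ≤ β) (hd : 9 * (d : ℝ) ≤ N)
    (hγ : 2 * γ * Real.log m ≤ N) :
    1 - n * (m : ℝ) ^ (-γ) - 2 * (n : ℝ) ^ (-β) ≤
      P.real {ω | ‖M ω - expectedMatrix P M‖ ≤ 5000 * β * √N} := by
  have hn : 1 ≤ n := hm.trans hmn
  have hn0 : (0 : ℝ) < n := by exact_mod_cast hn
  have hm0 : (0 : ℝ) < m := by exact_mod_cast hm
  -- If the claimed probability is positive, then `n ≥ 2` and `log n ≤ γ log m`, so `N ≥ 2 log 2 >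
  -- 1`. This supplies `1 ≤ c` for the heavy couples.
  by_cases htriv : 1 - n * (m : ℝ) ^ (-γ) - 2 * (n : ℝ) ^ (-β) ≤ 0
  · exact htriv.trans measureReal_nonneg
  have hb0 : 0 < (n : ℝ) ^ (-β) := Real.rpow_pos_of_pos hn0 _
  have hn2 : 2 ≤ n := by
    by_contra hlt
    have : n = 1 := by omega
    subst this
    simp only [Nat.cast_one, Real.one_rpow] at htriv
    have : 0 < (m : ℝ) ^ (-γ) := Real.rpow_pos_of_pos hm0 _
    linarith
  have hlogn : Real.log n ≤ γ * Real.log m := by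
    have h1 : n * (m : ℝ) ^ (-γ) < 1 := by linarith
    have h2 : Real.exp (Real.log n + Real.log m * -γ) < Real.exp 0 := by
      rwa [Real.exp_add, Real.exp_log hn0, ← Real.rpow_def_of_pos hm0, Real.exp_zero]
    have := Real.exp_lt_exp.1 h2
    linarith
  have hN1 : 1 ≤ N := by
    have h1 : Real.log 2 ≤ Real.log n := Real.log_le_log (by norm_num) (by exact_mod_cast hn2)
    linarith [Real.log_two_gt_d9]
  have hc : 1 ≤ √N := Real.one_le_sqrt.2 hN1
  have hcN : √N ^ 2 = N := Real.sq_sqrt (by linarith)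
  have hd0 : (0 : ℝ) ≤ d := by positivity
  have hβ0 : 0 ≤ β := by linarith
  obtain ⟨s, hs, hs1, hsnet⟩ := exists_half_net m
  obtain ⟨r, hr, hr1, hrnet⟩ := exists_half_net n
  have b1 := h.prob_column_le hm hmn (hcN ▸ hd) (hcN ▸ hγ)
  have b2 := h.prob_discrepancy_le (c := √N) hn hmn (by linarith) hβ
  have b3 := h.prob_net_le (c := √N) hn hmn (by linarith) (by linarith) hβ hs hr hs1 hr1
  set G := {ω | ‖M ω - expectedMatrix P M‖ ≤ 5000 * β * √N} with hG
  set B1 := {ω | ∃ j, √N ^ 2 < ∑ i, M ω i j}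
  set B2 := {ω | ¬ HasDiscrepancy (M ω) n √N (6 * β)}
  set B3 := {ω | ∃ x ∈ s, ∃ y ∈ r, 7 * β * √N < lightForm (√N / n) (d / n) (M ω) x y}
  have hcover : ∀ᵐ ω ∂P, ω ∈ G ∪ (B1 ∪ (B2 ∪ B3)) := by
    filter_upwards [h.ae_mem] with ω hω
    by_contra hbad
    simp only [Set.mem_union, not_or] at hbad
    obtain ⟨hG', h1, h2, h3⟩ := hbad
    simp only [B1, B2, B3, Set.mem_ofPred_eq, not_exists, not_lt, not_not, not_and] at h1 h2 h3
    apply hG'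
    rw [hG, Set.mem_ofPred_eq, h.expectedMatrix_eq]
    have hsq : ∀ {k : ℕ} (x : EuclideanSpace ℝ (Fin k)), ‖x‖ ≤ 1 → ∑ i, x i ^ 2 ≤ 1 := by
      intro k x hx
      rw [← EuclideanSpace.real_norm_sq_eq]
      exact pow_le_one₀ (norm_nonneg _) hx
    -- Light part, heavy part with `B = 6β`, and mean over the heavy couples. Four times their sum
    -- is `(3868β + 1092)√N ≤ 5000β√N`.
    have key := l2_opNorm_le_of_net hsnet hrnet (M ω - Matrix.of fun _ _ => (d : ℝ) / n)
      (t := 7 * β * √N + 2 * ((136 + 80 * (6 * β)) * √N) + √N) (by positivity) (by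
        intro x hx y hy
        refine bilinear_sub_le_of_light (p := (d : ℝ) / n) (A := M ω) hn hmn hc (by linarith) (by positivity) ?_ ?_ ?_ h1 h2
          (hsq _ (hs1 x hx)) (hsq _ (hr1 y hy)) (h3 x hx y hy)
        · rw [div_mul_cancel₀ _ hn0.ne', hcN]
          linarith
        · intro i j
          rcases (hω i).1 j with h0 | h0 <;> simp [h0]
        · intro i
          rw [sum_eq_of_mem_zeroOneVectors (hω i), hcN]
          linarith)
    refine key.trans ?_
    nlinarith
  have htot : (1 : ℝ) ≤ P.real G + (P.real B1 + (P.real B2 + P.real B3)) := by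
    have h1 : P.real (G ∪ (B1 ∪ (B2 ∪ B3))) = 1 := by
      have h0 : (G ∪ (B1 ∪ (B2 ∪ B3)) : Set Ω) =ᵐ[P] Set.univ := Filter.eventuallyEq_univ.2 hcover
      rw [measureReal_congr h0, probReal_univ]
    rw [← h1]
    refine (measureReal_union_le _ _).trans (add_le_add_right ?_ _)
    refine (measureReal_union_le _ _).trans (add_le_add_right ?_ _)
    exact measureReal_union_le _ _
  linarith

/-- The norm bound with the density of the ones or of the zeros, whichever is smaller. -/
theorem IsRandomCombinatorial.norm_sub_expectedMatrix_le (h : IsRandomCombinatorial P d M)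
    (hm : 1 ≤ m) (hmn : m ≤ n) (hdn : d ≤ n) {N γ β : ℝ} (hβ : 1 ≤ β)
    (hd : 9 * min (d : ℝ) ((n : ℝ) - d) ≤ N) (hγ : 2 * γ * Real.log m ≤ N) :
    1 - n * (m : ℝ) ^ (-γ) - 2 * (n : ℝ) ^ (-β) ≤
      P.real {ω | ‖M ω - expectedMatrix P M‖ ≤ 5000 * β * √N} := by
  have hn : 1 ≤ n := hm.trans hmn
  have hn0 : (n : ℝ) ≠ 0 := by positivity
  rcases le_total (d : ℝ) ((n : ℝ) - d) with hle | hle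
  · rw [min_eq_left hle] at hd
    exact (h.isPoissonDominated hn hdn).norm_sub_expectedMatrix_le hm hmn hβ hd hγ
  · rw [min_eq_right hle] at hd
    have h1 := h.isPoissonDominated hn hdn
    have h2 := h.isPoissonDominated_compl hn hdn
    have h3 := h2.norm_sub_expectedMatrix_le hm hmn hβ (by push_cast [Nat.cast_sub hdn]; exact hd) hγ
    refine h3.trans_eq ?_
    congr 1
    ext ω
    simp only [Set.mem_ofPred_eq]
    -- Centering the complement gives minus the centered matrix, so the norms agree.
    rw [h1.expectedMatrix_eq, h2.expectedMatrix_eq, ← norm_neg (M ω - _)]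
    congr! 2
    ext i j
    simp only [Matrix.sub_apply, Matrix.of_apply, Matrix.neg_apply, Nat.cast_sub hdn]
    field_simp
    ring

end

/-! ### Transposition, comparison of the two bounds, and conclusion -/

theorem norm_sub_expectedMatrix_transpose {Ω : Type*} [MeasurableSpace Ω] (P : Measure Ω) {m n : ℕ}
    (M : Ω → Matrix (Fin m) (Fin n) ℝ) (ω : Ω) :
    ‖M ω - expectedMatrix P M‖ = ‖(M ω)ᵀ - expectedMatrix P (fun ω' => (M ω')ᵀ)‖ := by
  rw [← Matrix.l2_opNorm_conjTranspose, Matrix.conjTranspose_eq_transpose_of_trivial,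
    Matrix.transpose_sub]
  rfl

theorem norm_bound_le {D G N β : ℝ} (hD : 0 ≤ D) (hG : 0 ≤ G) (hβ : 1 ≤ β)
    (hN : N = max (9 * D) (2 * G)) :
    2 * D / √N + 5000 * β * √N ≤ 20000 * β * √(D + G) := by
  have hDN : 9 * D ≤ N := hN ▸ le_max_left _ _
  have hNle : N ≤ 3 ^ 2 * (D + G) := by
    rw [hN]; exact max_le (by linarith) (by linarith)
  have hN0 : 0 ≤ N := by linarith
  have hs : √N ≤ 3 * √(D + G) := by
    calc √N ≤ √(3 ^ 2 * (D + G)) := Real.sqrt_le_sqrt hNle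
      _ = 3 * √(D + G) := by
        rw [Real.sqrt_mul (by norm_num), Real.sqrt_sq (by norm_num)]
  have h1 : 2 * D / √N ≤ √N := by
    -- This form of the division bound covers `N = 0`, where the quotient is 0 by convention.
    refine div_le_of_le_mul₀ (Real.sqrt_nonneg _) (Real.sqrt_nonneg _) ?_
    rw [Real.mul_self_sqrt hN0]
    linarith
  have h2 : √N ≤ β * √N := le_mul_of_one_le_left (Real.sqrt_nonneg _) hβ
  calc 2 * D / √N + 5000 * β * √N ≤ 5001 * β * √N := by linarith
    _ ≤ 5001 * β * (3 * √(D + G)) := by gcongr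
    _ ≤ 20000 * β * √(D + G) := by
        have : 0 ≤ β * √(D + G) := by positivity
        linarith

/-- Here `‖A‖` is the operator norm of `A` from `ℓ₂ⁿ` to `ℓ₂ᵐ`. -/
theorem theorem4p1 :
    ∃ C₁ C₂ : ℝ, 0 < C₁ ∧ 0 < C₂ ∧
      (∀ (m n d : ℕ) (γ β N : ℝ),
        1 ≤ m → m ≤ n → 4 ≤ γ → 1 ≤ β → 1 ≤ d → d ≤ n →
        N = max (9 * min (d : ℝ) ((n : ℝ) - d)) (2 * γ * Real.log m) →
        ∀ (Ω : Type*) [MeasurableSpace Ω] (P : Measure Ω) [IsProbabilityMeasure P]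
          (M : Ω → Matrix (Fin m) (Fin n) ℝ), IsRandomCombinatorial P d M →
          1 - (n : ℝ) * (m : ℝ) ^ (-γ) - 2 * (n : ℝ) ^ (-β) ≤
            P.real {ω |
              ‖M ω - expectedMatrix P M‖ ≤
                2 * min (d : ℝ) ((n : ℝ) - d) / √N + C₁ * β * √N ∧
              2 * min (d : ℝ) ((n : ℝ) - d) / √N + C₁ * β * √N ≤
                C₂ * β * √(min (d : ℝ) ((n : ℝ) - d) + γ * Real.log m)}) ∧
      (∀ (n d : ℕ), 1 ≤ d → d ≤ n → Real.log n ≤ d → (d : ℝ) ≤ n - Real.log n →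
        ∀ (Ω : Type*) [MeasurableSpace Ω] (P : Measure Ω) [IsProbabilityMeasure P]
          (M : Ω → Matrix (Fin n) (Fin n) ℝ), IsRandomCombinatorial P d M →
          1 - 3 * (n : ℝ)⁻¹ ≤
            P.real {ω |
              ‖M ω - expectedMatrix P M‖ =
                ‖(M ω)ᵀ - expectedMatrix P (fun ω' => (M ω')ᵀ)‖ ∧
              ‖M ω - expectedMatrix P M‖ ≤ C₂ * √(d : ℝ)}) := by
  refine ⟨5000, 60000, by norm_num, by norm_num, ?_, ?_⟩
  · intro m n d γ β N hm hmn hγ hβ _ hdn hN Ω _ P _ M hM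
    have hlog : 0 ≤ Real.log m := Real.log_nonneg (by exact_mod_cast hm)
    have hD : 0 ≤ min (d : ℝ) ((n : ℝ) - d) :=
      le_min (by positivity) (sub_nonneg.2 (by exact_mod_cast hdn))
    have hG : 0 ≤ γ * Real.log m := by positivity
    have h1 := norm_bound_le (N := N) hD hG hβ (by rw [hN, mul_assoc])
    have h2 := hM.norm_sub_expectedMatrix_le hm hmn hdn hβ (hN ▸ le_max_left _ _)
      (hN ▸ le_max_right _ _)
    refine h2.trans (measureReal_mono fun ω hω => ?_)
    rw [Set.mem_ofPred_eq] at hω ⊢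
    refine ⟨hω.trans (le_add_of_nonneg_left (by positivity)), h1.trans ?_⟩
    gcongr
    norm_num
  · intro n d _ hdn hd1 hd2 Ω _ P _ M hM
    have hn : 1 ≤ n := by omega
    have hn0 : (0 : ℝ) < n := by exact_mod_cast hn
    have hlog : 0 ≤ Real.log n := Real.log_nonneg (by exact_mod_cast hn)
    have hD : Real.log n ≤ min (d : ℝ) ((n : ℝ) - d) := le_min hd1 (by linarith)
    have hD' : min (d : ℝ) ((n : ℝ) - d) ≤ d := min_le_left _ _
    -- The square case takes `γ = 4` and `β = 1`. As `log n ≤ d`, both entries of the maximum are at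
    -- most `9d`, and the column failure `n * n^(-4)` is at most `n⁻¹`.
    obtain ⟨N, hN⟩ : ∃ N, N = max (9 * min (d : ℝ) ((n : ℝ) - d)) (2 * 4 * Real.log n) :=
      ⟨_, rfl⟩
    have h2 := hM.norm_sub_expectedMatrix_le hn le_rfl hdn (le_refl 1) (hN ▸ le_max_left _ _)
      (hN ▸ le_max_right _ _)
    have hNd : N ≤ 3 ^ 2 * d := by rw [hN]; exact max_le (by linarith) (by linarith)
    have hs : √N ≤ 3 * √(d : ℝ) := by
      calc √N ≤ √(3 ^ 2 * (d : ℝ)) := Real.sqrt_le_sqrt hNd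
        _ = 3 * √(d : ℝ) := by
          rw [Real.sqrt_mul (by norm_num), Real.sqrt_sq (by norm_num)]
    have hprob : 1 - 3 * (n : ℝ)⁻¹ ≤ 1 - n * (n : ℝ) ^ (-(4 : ℝ)) - 2 * (n : ℝ) ^ (-(1 : ℝ)) := by
      have h3 : n * (n : ℝ) ^ (-(4 : ℝ)) ≤ (n : ℝ)⁻¹ := by
        rw [← Real.rpow_neg_one, ← Real.rpow_one_add' hn0.le (by norm_num)]
        exact Real.rpow_le_rpow_of_exponent_le (by exact_mod_cast hn) (by norm_num)
      rw [Real.rpow_neg_one]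
      linarith
    refine hprob.trans (h2.trans (measureReal_mono fun ω hω => ?_))
    rw [Set.mem_ofPred_eq] at hω ⊢
    refine ⟨norm_sub_expectedMatrix_transpose P M ω, hω.trans ?_⟩
    have := Real.sqrt_nonneg (d : ℝ)
    linarith
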